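/- **Spohn's formula for the covariance.** Let $d\ge 2$ and $\mathbb D=\mathbb T^d\times\mathbb R^d\ni z=(x,v)$. For $\omega\in\mathbb S^{d-1}$ put $v'=v-((v-w)\cdot\omega)\,\omega$, $w'=w+((v-w)\cdot\omega)\,\omega$. Let $\beta_0>0$, $T^\star>0$, and let $f$ be a (measurable, mild) solution on $[0,T^\star]$ of the Boltzmann equation $$\partial_t f+v\cdot\nabla_x f=\int_{\mathbb R^d}\int_{\mathbb S^{d-1}}\big(f(t,x,w')f(t,x,v')-f(t,x,w)f(t,x,v)\big)\,((v-w)\cdot\omega)_+\,d\omega\,dw,\qquad f(0)=f^0,$$ such that, for some constant $M$, $|f(t,x,v)|\le M\exp\big(-\tfrac{\beta_0}{2}|v|^2(1-\tfrac{t}{2T^\star})\big)$ on $[0,T^\star]\times\mathbb D$. For $\beta>0$ let $L^2_\beta$ be the space of functions $\varphi$ on $\mathbb D$ with $\int_{\mathbb D} e^{-\frac{\beta}{2}|v|^2}\varphi^2\,dx\,dv<\infty$. Put $\Delta\psi(x,v,w,\omega)=\psi(x,v')+\psi(x,w')-\psi(x,v)-\psi(x,w)$ and $$\mathbf L_s^*\psi(x,v)=\iint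 f(s,x,w)\,\Delta\psi(x,v,w,\omega)\,((v-w)\cdot\omega)_+\,d\omega\,dw,$$ $$\mathbf{Cov}_u(\varphi,\psi)=\frac12\int f(u,x,v)f(u,x,w)\,\Delta\psi\,\Delta\varphi\,((v-w)\cdot\omega)_+\,d\omega\,dx\,dv\,dw .$$ Then there is a time $T\in(0,T^\star]$, depending only on $d,\beta_0,T^\star,M$, such that the following holds. (i) For all $t\in[0,T]$ and $\varphi\in L^2_{\beta_0/2}$, the backward linearized equation $\partial_s\psi_s+v\cdot\nabla_x\psi_s+\mathbf L_s^*\psi_s=0$, $\psi_t=\varphi$, understood in Duhamel form, has a unique solution on $[0,t]$ (up to null sets, for each $s$) which is bounded with values in $L^2_{3\beta_0/4}$. It is denoted $\psi_s=\mathcal U^*(t,s)\varphi$. (ii) For all $0\le s\le t\le T$ and $\varphi,\psi\in L^2_{\beta_0/2}$, the covariance of the limiting fluctuation field, $$\hat{\mathcal C}(s,t,\varphi,\psi):=\int f^0\;\mathcal U^*(t,0)\psi\;\mathcal U^*(s,0)\varphi\,dz+\int_0^s\mathbf{Cov}_u\big(\mathcal U^*(t,u)\psi,\mathcal U^*(s,u)\varphi\big)\,du,$$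 satisfies $$\hat{\mathcal C}(s,t,\varphi,\psi)=\int \mathcal U^*(t,s)\psi(z)\,\varphi(z)\,f(s,z)\,dz+\int_0^{s}d\tau\int dx\,dv\,dw\;R^{1,2}\big(f(\tau),f(\tau)\big)(x,v,w)\,\big(\mathcal U^*(t,\tau)\psi\big)(x,v)\,\big(\mathcal U^*(s,\tau)\varphi\big)(x,w),$$ where the recollision operator is $$R^{1,2}(g,g)(x,v,w)=\int_{\mathbb S^{d-1}}\big(g(x,v')g(x,w')-g(x,v)g(x,w)\big)\,((v-w)\cdot\omega)_+\,d\omega ,$$ and all these integrals converge absolutely. -/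

import Mathlib

open MeasureTheory

open scoped NNReal ENNReal

noncomputable section

namespace FluctuatingBoltzmann

/-- The flat torus of dimension `d`. -/
abbrev Torus (d : ℕ) : Type := Fin d → UnitAddCircle

/-- The space of velocities, with its Euclidean structure. -/
abbrev Vel (d : ℕ) : Type := EuclideanSpace ℝ (Fin d)

/-- The one-particle phase space; `z = (x, v)`. -/
abbrev Phase (d : ℕ) : Type := Torus d × Vel d

/-- The unit sphere of the space of velocities. -/
abbrev Sph (d : ℕ) : Type := Metric.sphere (0 : Vel d) 1

/-- The surface measure `dω` on the unit sphere. -/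
abbrev surf (d : ℕ) : Measure (Sph d) := (volume : Measure (Vel d)).toSphere

variable {d : ℕ}

/-- `v' = v - ((v - w) · ω) ω`. -/
def scatV (v w : Vel d) (ω : Sph d) : Vel d := v - (inner ℝ (v - w) (ω : Vel d)) • (ω : Vel d)

/-- `w' = w + ((v - w) · ω) ω`. -/
def scatW (v w : Vel d) (ω : Sph d) : Vel d := w + (inner ℝ (v - w) (ω : Vel d)) • (ω : Vel d)

/-- The hard-sphere cross section `((v - w) · ω)₊`. -/
def kernel (v w : Vel d) (ω : Sph d) : ℝ := max (inner ℝ (v - w) (ω : Vel d)) 0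

/-- `(x, v) ↦ (x + τ v, v)`. -/
def shift (τ : ℝ) (z : Phase d) : Phase d :=
  (fun i => z.1 i + ((τ * z.2 i : ℝ) : UnitAddCircle), z.2)

/-- The Boltzmann collision operator
`∫∫ (g(x,w') g(x,v') - g(x,w) g(x,v)) ((v - w) · ω)₊ dω dw`. -/
def collisionOp (g : Phase d → ℝ) (z : Phase d) : ℝ :=
  ∫ p : Vel d × Sph d,
    (g (z.1, scatW z.2 p.1 p.2) * g (z.1, scatV z.2 p.1 p.2) - g (z.1, p.1) * g (z.1, z.2))
      * kernel z.2 p.1 p.2 ∂((volume : Measure (Vel d)).prod (surf d))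

/-- `f` is a solution on `[0, Tstar]` of the Boltzmann equation
`∂ₜ f + v · ∇ₓ f = collisionOp f` with initial datum `f₀` (in integrated form along the
characteristics of free transport) with the Gaussian bound
`|f(t,x,v)| ≤ M exp (- (β₀/2) |v|² (1 - t / (2 Tstar)))`. -/
structure IsBoltzmannSolution (β₀ Tstar M : ℝ) (f₀ : Phase d → ℝ) (f : ℝ → Phase d → ℝ) :
    Prop where
  measurable : Measurable (fun p : ℝ × Phase d => f p.1 p.2)
  bound : ∀ t ∈ Set.Icc 0 Tstar, ∀ z : Phase d,
    |f t z| ≤ M * Real.exp (-(β₀ / 2 * ‖z.2‖ ^ 2 * (1 - t / (2 * Tstar))))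
  equation : ∀ t ∈ Set.Icc 0 Tstar, ∀ z : Phase d,
    f t z = f₀ (shift (-t) z) + ∫ σ in (0 : ℝ)..t, collisionOp (f σ) (shift (-(t - σ)) z)

/-- The measure `exp (- (β/2) |v|²) dx dv`. -/
def weighted (d : ℕ) (β : ℝ) : Measure (Phase d) :=
  (volume : Measure (Phase d)).withDensity
    (fun z => ENNReal.ofReal (Real.exp (-(β / 2 * ‖z.2‖ ^ 2))))

/-- Membership in `L²_β`, i.e. `∫ exp (- (β/2) |v|²) φ² dx dv < ∞`. -/
def MemL2 (β : ℝ) (φ : Phase d → ℝ) : Prop := MemLp φ 2 (weighted d β)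

/-- `Δψ (z₁, z₂, ω) = ψ(z₁') + ψ(z₂') - ψ(z₁) - ψ(z₂)` for `z₁ = (x, v)`, `z₂ = (x, w)`. -/
def collDiff (ψ : Phase d → ℝ) (x : Torus d) (v w : Vel d) (ω : Sph d) : ℝ :=
  ψ (x, scatV v w ω) + ψ (x, scatW v w ω) - ψ (x, v) - ψ (x, w)

/-- The collisional part of the adjoint linearized operator around `g`:
`∫∫ g(x,w) Δψ ((v - w) · ω)₊ dω dw`. -/
def linAdjoint (g ψ : Phase d → ℝ) (z : Phase d) : ℝ :=
  ∫ p : Vel d × Sph d, g (z.1, p.1) * collDiff ψ z.1 z.2 p.1 p.2 * kernel z.2 p.1 p.2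
    ∂((volume : Measure (Vel d)).prod (surf d))

/-- `Ψ` solves on `[0, t]` the backward linearized Boltzmann equation
`∂ₛ Ψₛ + v · ∇ₓ Ψₛ + linAdjoint (f s) Ψₛ = 0`, `Ψₜ = φ`, in Duhamel form, and is bounded
on `[0, t]` with values in `L²_{3 β₀ / 4}`. -/
structure IsBackwardSolution (β₀ : ℝ) (f : ℝ → Phase d → ℝ) (t : ℝ) (φ : Phase d → ℝ)
    (Ψ : ℝ → Phase d → ℝ) : Prop where
  measurable : Measurable (fun p : ℝ × Phase d => Ψ p.1 p.2)
  bound : ∃ C : ℝ≥0, ∀ s ∈ Set.Icc 0 t, eLpNorm (Ψ s) 2 (weighted d (3 * β₀ / 4)) ≤ C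
  equation : ∀ s ∈ Set.Icc 0 t, ∀ᵐ z : Phase d,
    Ψ s z = φ (shift (t - s) z) + ∫ σ in s..t, linAdjoint (f σ) (Ψ σ) (shift (σ - s) z)

open scoped Classical in
/-- The propagator `U*(t, s) φ` : the value at time `s` of the solution of the backward
linearized Boltzmann equation around `f` that equals `φ` at time `t` (and `0` if there is no
solution). -/
def Ustar (β₀ : ℝ) (f : ℝ → Phase d → ℝ) (t s : ℝ) (φ : Phase d → ℝ) : Phase d → ℝ :=
  if h : ∃ Ψ, IsBackwardSolution β₀ f t φ Ψ then h.choose s else 0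

/-- The density `g(z₁) g(z₂) Δψ Δφ ((v - w) · ω)₊`, at `q = ((x, v, w), ω)`. -/
def covDensity (g φ ψ : Phase d → ℝ) (q : (Torus d × Vel d × Vel d) × Sph d) : ℝ :=
  g (q.1.1, q.1.2.1) * g (q.1.1, q.1.2.2)
    * collDiff ψ q.1.1 q.1.2.1 q.1.2.2 q.2 * collDiff φ q.1.1 q.1.2.1 q.1.2.2 q.2
    * kernel q.1.2.1 q.1.2.2 q.2

/-- The noise covariance `Cov (φ, ψ) = ½ ∫ dμ(z₁, z₂, ω) g(z₁) g(z₂) Δψ Δφ`. -/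
def noiseCov (g φ ψ : Phase d → ℝ) : ℝ :=
  (1 / 2 : ℝ) * ∫ q, covDensity g φ ψ q
    ∂((volume : Measure (Torus d × Vel d × Vel d)).prod (surf d))

/-- The covariance of the limiting fluctuation field:
`∫ f₀ U*(t,0)ψ U*(s,0)φ dz + ∫₀ˢ Cov_u (U*(t,u)ψ, U*(s,u)φ) du`. -/
def limitCov (β₀ : ℝ) (f₀ : Phase d → ℝ) (f : ℝ → Phase d → ℝ) (s t : ℝ)
    (φ ψ : Phase d → ℝ) : ℝ :=
  (∫ z, f₀ z * Ustar β₀ f t 0 ψ z * Ustar β₀ f s 0 φ z)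
    + ∫ u in (0 : ℝ)..s, noiseCov (f u) (Ustar β₀ f t u ψ) (Ustar β₀ f s u φ)

/-- The recollision operator
`R(g,g)(x,v,w) = ∫ (g(x,v') g(x,w') - g(x,v) g(x,w)) ((v - w) · ω)₊ dω`. -/
def recollision (g : Phase d → ℝ) (x : Torus d) (v w : Vel d) : ℝ :=
  ∫ ω : Sph d, (g (x, scatV v w ω) * g (x, scatW v w ω) - g (x, v) * g (x, w)) * kernel v w ω
    ∂(surf d)

/-- `R(g,g)(x,v,w) ψ(x,v) φ(x,w)`, at `q = (x, v, w)`. -/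
def recollisionDensity (g ψ φ : Phase d → ℝ) (q : Torus d × Vel d × Vel d) : ℝ :=
  recollision g q.1 q.2.1 q.2.2 * ψ (q.1, q.2.1) * φ (q.1, q.2.2)

end FluctuatingBoltzmann

end

open FluctuatingBoltzmann

noncomputable section

open Set Filter Topology

namespace FluctuatingBoltzmann

/-! Let `Ψ` and `Φ` be the backward solutions issued from `ψ` at time `t` and from `φ` at time `s`.
Along the characteristics of free transport, `f Ψ Φ` has the derivative `Q(f) Ψ Φ - f (L*Ψ) Φ - f Ψ
(L*Φ)`, where `Q` is the collision operator; this is `productRate`. Integrating it over `[0, s]` and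
over phase space gives `∫ f Ψ Φ` at time `s` minus the same integral at time `0`
(`integral_productRate`). The formula then reduces to an identity between collision integrals: half
of the integrated covariance density equals the integral of `productRate` plus the recollision term
(`half_integral_covDensity_eq`).

To prove that identity, let `P i j` be the integral of `f(z₁) f(z₂) Ψ(zᵢ) Φ(zⱼ)` against the cross
section, with `zᵢ`, `zⱼ` among the four positions of a collision (`pairingIntegral`). Every term is
a combination of the `P i j`: the gain terms become loss terms under the reversal of collisions
(`integral_gainPairing`), and exchanging the two particles identifies the `P i j` in pairs
(`pairingIntegral_exchange`). What remains is linear arithmetic.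

The analytic part is the backward equation. Because the cross section grows linearly in the
velocities, the linearized operator maps `L²_β` only into `L²_β'` with `β' > β`, with squared norm
of order `1/(β' - β)` (`wnorm_absLin_le`). Letting the weight grow linearly as time runs backwards,
the loss `(σ - s)^(-1/2)` in norm is integrable in time, and on a short interval the Duhamel
operator contracts squared norms by `1/8` (`IsShortTime.wnorm_absStep_le`). Existence follows by a
Neumann series summed pointwise (`exists_neumann_series`), uniqueness by iterating the contraction
on a difference. Weights run from `β₀/2` to `5β₀/8` for existence and from `3β₀/4` to `7β₀/8` for
uniqueness; the last value is the Gaussian decay required of `f`. The gap between `3β₀/4` and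
`7β₀/8` also makes every collision integral absolutely convergent (`integrable_pairing`). -/

/-! ### Elementary inequalities, a product rule, and pointwise Neumann series. -/

theorem lintegral_mul_sq_le {α : Type*} [MeasurableSpace α] (μ : Measure α) {f g : α → ℝ≥0∞}
    (hf : AEMeasurable f μ) (hg : AEMeasurable g μ) :
    (∫⁻ a, f a * g a ∂μ) ^ 2 ≤ (∫⁻ a, f a ^ 2 ∂μ) * ∫⁻ a, g a ^ 2 ∂μ := by
  have h := ENNReal.lintegral_mul_le_Lp_mul_Lq μ Real.HolderConjugate.two_two hf hg
  simp only [Pi.mul_apply, ENNReal.rpow_two] at h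
  calc (∫⁻ a, f a * g a ∂μ) ^ 2
      ≤ ((∫⁻ a, f a ^ 2 ∂μ) ^ (1 / 2 : ℝ) * (∫⁻ a, g a ^ 2 ∂μ) ^ (1 / 2 : ℝ)) ^ 2 := by gcongr
    _ = _ := by
      rw [mul_pow, ← ENNReal.rpow_natCast, ← ENNReal.rpow_natCast, ← ENNReal.rpow_mul,
        ← ENNReal.rpow_mul]
      norm_num

theorem mul_le_sq_add_sq (a b : ℝ≥0∞) : a * b ≤ a ^ 2 + b ^ 2 := by
  rcases le_total a b with h | h
  · calc a * b ≤ b * b := by gcongr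
      _ ≤ _ := by rw [← sq]; exact le_add_self
  · calc a * b ≤ a * a := by gcongr
      _ ≤ _ := by rw [← sq]; exact le_self_add

theorem add_sq_le_two_mul (a b : ℝ≥0∞) : (a + b) ^ 2 ≤ 2 * (a ^ 2 + b ^ 2) := by
  rw [add_sq, mul_assoc, two_mul, two_mul]
  have := mul_le_sq_add_sq a b
  have h : a * b + a * b ≤ a ^ 2 + b ^ 2 := by
    rcases le_total a b with h | h
    all_goals obtain ⟨c, rfl⟩ := exists_add_of_le h
    · calc a * (a + c) + a * (a + c) ≤ a * (a + c) + a * (a + c) + c * c := le_self_add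
        _ = _ := by ring
    · calc (b + c) * b + (b + c) * b ≤ (b + c) * b + (b + c) * b + c * c := le_self_add
        _ = _ := by ring
  calc a ^ 2 + (a * b + a * b) + b ^ 2 = (a ^ 2 + b ^ 2) + (a * b + a * b) := by ring
    _ ≤ _ := by gcongr

theorem sum_four_sq_le (H : Fin 4 → ℝ≥0∞) : (∑ i, H i) ^ 2 ≤ 4 * ∑ i, H i ^ 2 := by
  rw [Fin.sum_univ_four, Fin.sum_univ_four]
  calc (H 0 + H 1 + H 2 + H 3) ^ 2 = ((H 0 + H 1) + (H 2 + H 3)) ^ 2 := by ring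
    _ ≤ 2 * ((H 0 + H 1) ^ 2 + (H 2 + H 3) ^ 2) := add_sq_le_two_mul _ _
    _ ≤ 2 * (2 * (H 0 ^ 2 + H 1 ^ 2) + 2 * (H 2 ^ 2 + H 3 ^ 2)) := by
        gcongr <;> exact add_sq_le_two_mul _ _
    _ = _ := by ring

/-- The product of three indefinite integrals is absolutely continuous, with the derivative given
by the product rule. -/
theorem integral_triple_product {s a₀ b₀ c₀ : ℝ} {q l m : ℝ → ℝ}
    (hq : IntervalIntegrable q volume 0 s) (hl : IntervalIntegrable l volume 0 s)
    (hm : IntervalIntegrable m volume 0 s) {A B C : ℝ → ℝ}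
    (hA : ∀ u, A u = a₀ + ∫ σ in (0 : ℝ)..u, q σ) (hB : ∀ u, B u = b₀ + ∫ σ in (0 : ℝ)..u, l σ)
    (hC : ∀ u, C u = c₀ + ∫ σ in (0 : ℝ)..u, m σ) :
    A s * B s * C s - a₀ * b₀ * c₀
      = ∫ u in (0 : ℝ)..s, q u * B u * C u + A u * l u * C u + A u * B u * m u := by
  have key : ∀ {r : ℝ → ℝ} {D : ℝ → ℝ} {d₀ : ℝ}, IntervalIntegrable r volume 0 s →
      (∀ u, D u = d₀ + ∫ σ in (0 : ℝ)..u, r σ) → AbsolutelyContinuousOnInterval D 0 s := by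
    intro r D d₀ hr hD
    have h1 := hr.absolutelyContinuousOnInterval_intervalIntegral (c := 0) (by simp)
    have h2 : AbsolutelyContinuousOnInterval (fun _ : ℝ => d₀) 0 s :=
      (LipschitzWith.const d₀).lipschitzOnWith.absolutelyContinuousOnInterval
    have h3 := h2.add h1
    have : D = (fun _ : ℝ => d₀) + fun u => ∫ σ in (0 : ℝ)..u, r σ := by
      ext u; simp [hD]
    rwa [this]
  have hAB := (key hq hA).fun_mul (key hl hB)
  have hABC := hAB.fun_mul (key hm hC)
  have h0 : a₀ * b₀ * c₀ = A 0 * B 0 * C 0 := by simp [hA, hB, hC]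
  rw [h0, ← hABC.integral_deriv_eq_sub]
  apply intervalIntegral.integral_congr_ae
  -- Absolute continuity gives the fundamental theorem for the product; Lebesgue differentiation of
  -- each factor identifies its derivative almost everywhere.
  filter_upwards [hq.ae_hasDerivAt_integral, hl.ae_hasDerivAt_integral, hm.ae_hasDerivAt_integral]
    with u h1 h2 h3 hu
  have hu' := uIoc_subset_uIcc hu
  have e1 : HasDerivAt A (q u) u := by
    simpa [funext hA] using (h1 hu' 0 (by simp)).const_add a₀
  have e2 : HasDerivAt B (l u) u := by
    simpa [funext hB] using (h2 hu' 0 (by simp)).const_add b₀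
  have e3 : HasDerivAt C (m u) u := by
    simpa [funext hC] using (h3 hu' 0 (by simp)).const_add c₀
  refine ((e1.mul e2).mul e3).deriv.trans ?_
  simp only [Pi.mul_apply]
  ring

/-- Neumann series for a linear integral equation `Ψ = h + KΨ` with
`K Ψ x = ∫ ∑ i, a i x y * Ψ (π i x y) dν(y)`. -/
theorem exists_neumann_series {X Y ι : Type*} [MeasurableSpace X] [MeasurableSpace Y] [Fintype ι]
    (ν : Measure Y) [SFinite ν] {a : ι → X → Y → ℝ} {π : ι → X → Y → X}
    (ha : ∀ i, Measurable (fun p : X × Y => a i p.1 p.2))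
    (hπ : ∀ i, Measurable (fun p : X × Y => π i p.1 p.2)) {h : X → ℝ} (hh : Measurable h) :
    ∃ (U : ℕ → X → ℝ≥0∞) (Ψ : X → ℝ), (∀ n, Measurable (U n)) ∧ Measurable Ψ ∧
      (U 0 = fun x => ‖h x‖ₑ) ∧
      (∀ n x, U (n + 1) x = ∫⁻ y, ∑ i, ‖a i x y‖ₑ * U n (π i x y) ∂ν) ∧
      (∀ x, ‖Ψ x‖ₑ ≤ ∑' n, U n x) ∧
      (∀ x, ∑' n, U n x ≠ ∞ →
        ∫⁻ y, ∑ i, ‖a i x y‖ₑ * ‖Ψ (π i x y)‖ₑ ∂ν ≠ ∞ ∧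
        Ψ x = h x + ∫ y, ∑ i, a i x y * Ψ (π i x y) ∂ν) := by
  have haπ : ∀ i x, Measurable (a i x) ∧ Measurable (π i x) := fun i x =>
    ⟨(ha i).comp measurable_prodMk_left, (hπ i).comp measurable_prodMk_left⟩
  let U : ℕ → X → ℝ≥0∞ := fun n => Nat.rec (fun x => ‖h x‖ₑ)
    (fun _ V x => ∫⁻ y, ∑ i, ‖a i x y‖ₑ * V (π i x y) ∂ν) n
  let u : ℕ → X → ℝ := fun n => Nat.rec h
    (fun _ v x => ∫ y, ∑ i, a i x y * v (π i x y) ∂ν) n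
  have hU : ∀ n, Measurable (U n) := by
    intro n
    induction n with
    | zero => exact hh.enorm
    | succ n ih =>
      apply Measurable.lintegral_prod_right (f := fun x y => ∑ i, ‖a i x y‖ₑ * U n (π i x y))
      exact Finset.measurable_sum _ fun i _ => (ha i).enorm.mul (ih.comp (hπ i))
  have hu : ∀ n, Measurable (u n) := by
    intro n
    induction n with
    | zero => exact hh
    | succ n ih =>
      apply StronglyMeasurable.measurable
      apply StronglyMeasurable.integral_prod_right (f := fun (x : X) (y : Y) => ∑ i, a i x y * u n (π i x y))
      apply Measurable.stronglyMeasurable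
      exact Finset.measurable_sum _ fun i _ => (ha i).mul (ih.comp (hπ i))
  have hsum : ∀ (v : X → ℝ) x y,
      ‖∑ i, a i x y * v (π i x y)‖ₑ ≤ ∑ i, ‖a i x y‖ₑ * ‖v (π i x y)‖ₑ := fun v x y =>
    (enorm_sum_le _ _).trans_eq (Finset.sum_congr rfl fun i _ => enorm_mul _ _)
  have huU : ∀ n x, ‖u n x‖ₑ ≤ U n x := by
    intro n
    induction n with
    | zero => exact fun x => le_rfl
    | succ n ih =>
      intro x
      refine (enorm_integral_le_lintegral_enorm _).trans (lintegral_mono fun y => ?_)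
      refine (hsum _ _ _).trans ?_
      gcongr
      exact ih _
  have hsummable : ∀ x, ∑' n, U n x ≠ ∞ → Summable fun n => ‖u n x‖ := by
    intro x hx
    have : ∑' n, ‖u n x‖ₑ ≠ ∞ := ne_top_of_le_ne_top hx (ENNReal.tsum_le_tsum fun n => huU n x)
    exact tsum_enorm_ne_top_iff_summable_norm.1 this
  refine ⟨U, fun x => ∑' n, u n x, hU, Measurable.tsum hu, rfl, fun n x => rfl, ?_, ?_⟩
  · intro x
    exact (enorm_tsum_le_tsum_enorm).trans (ENNReal.tsum_le_tsum fun n => huU n x)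
  · intro x hx
    have hG : ∫⁻ y, ∑ i, ‖a i x y‖ₑ * ∑' n, U n (π i x y) ∂ν = ∑' n, U (n + 1) x := by
      have : ∀ y, ∑ i, ‖a i x y‖ₑ * ∑' n, U n (π i x y)
          = ∑' n, ∑ i, ‖a i x y‖ₑ * U n (π i x y) := by
        intro y
        simp_rw [← ENNReal.tsum_mul_left]
        rw [Summable.tsum_finsetSum (fun _ _ => ENNReal.summable)]
      simp_rw [this]
      rw [lintegral_tsum]
      intro n
      exact (Finset.measurable_sum _ fun i _ =>
        (haπ i x).1.enorm.mul ((hU n).comp (haπ i x).2)).aemeasurable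
    have hG' : ∑' n, U (n + 1) x ≠ ∞ := by
      refine ne_top_of_le_ne_top hx ?_
      exact ENNReal.tsum_comp_le_tsum_of_injective (add_left_injective 1) fun n => U n x
    refine ⟨?_, ?_⟩
    · rw [← hG] at hG'
      refine ne_top_of_le_ne_top hG' (lintegral_mono fun y => ?_)
      gcongr
      exact (enorm_tsum_le_tsum_enorm).trans (ENNReal.tsum_le_tsum fun n => huU n _)
    · have hae : ∀ᵐ y ∂ν, ∑ i, ‖a i x y‖ₑ * ∑' n, U n (π i x y) < ∞ := by
        refine ae_lt_top ?_ (by rw [hG]; exact hG')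
        exact Finset.measurable_sum _ fun i _ => (haπ i x).1.enorm.mul
          ((Measurable.tsum hU).comp (haπ i x).2)
      have hcongr : ∫ y, ∑ i, a i x y * ∑' n, u n (π i x y) ∂ν
          = ∫ y, ∑' n, ∑ i, a i x y * u n (π i x y) ∂ν := by
        apply integral_congr_ae
        filter_upwards [hae] with y hy
        rw [Summable.tsum_finsetSum]
        · exact Finset.sum_congr rfl fun i _ => tsum_mul_left.symm
        · intro i _
          rw [ENNReal.sum_lt_top] at hy
          -- Finiteness of the weighted majorant gives no control at `π i x y` where the coefficient
          -- vanishes, but there the term itself is zero.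
          by_cases h0 : a i x y = 0
          · simp [h0, summable_zero]
          · apply Summable.mul_left
            refine (hsummable _ ?_).of_norm
            intro htop
            have := hy i (Finset.mem_univ i)
            rw [htop, ENNReal.mul_top (by simpa using h0)] at this
            exact lt_irrefl _ this
      change ∑' n, u n x = _
      rw [hcongr, integral_tsum, (hsummable x hx).of_norm.tsum_eq_zero_add]
      · rfl
      · intro n
        exact (Finset.measurable_sum _ fun i _ =>
          (haπ i x).1.mul ((hu n).comp (haπ i x).2)).aestronglyMeasurable
      · refine ne_top_of_le_ne_top hG' (ENNReal.tsum_le_tsum fun n => lintegral_mono fun y => ?_)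
        refine (hsum _ _ _).trans ?_
        gcongr
        exact huU _ _

/-- This is the price of a polynomial factor: a loss `δ` in the Gaussian weight absorbs `1 + y` at
the cost `1/δ`, by `1 + x ≤ exp x`. -/
theorem one_add_mul_exp_le {β₀ δ y : ℝ} (hδ : 0 < δ) (hδ' : δ ≤ β₀) (hy : 0 ≤ y) :
    (1 + y) * Real.exp (-(δ / 2 * y)) ≤ (β₀ + 2) / δ := by
  have h1 : δ / 2 * y + 1 ≤ Real.exp (δ / 2 * y) := Real.add_one_le_exp _
  rw [Real.exp_neg, ← div_eq_mul_inv, div_le_div_iff₀ (Real.exp_pos _) hδ]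
  have : 0 ≤ δ / 2 * y := by positivity
  nlinarith

/-! ### Geometry of collisions and the measure-preserving symmetries. -/

section

variable {d : ℕ}

/-- The surface measure of a set is, up to a dimensional factor, the volume of the cone over it, and
the antipodal map sends cones to their negatives. The symmetries of collisions flip `ω`, so they
need this invariance. -/
theorem map_neg_toSphere {E : Type*} [NormedAddCommGroup E] [NormedSpace ℝ E] [MeasurableSpace E]
    [BorelSpace E] (μ : Measure E) [μ.IsNegInvariant] :
    μ.toSphere.map (fun ω => -ω) = μ.toSphere := by
  open scoped Pointwise in
  have hm : Measurable fun ω : Metric.sphere (0 : E) 1 => -ω :=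
    continuous_neg.measurable
  ext s hs
  rw [Measure.map_apply hm hs, Measure.toSphere_apply' _ (hm hs), Measure.toSphere_apply' _ hs]
  congr 1
  rw [← Measure.measure_neg μ (Ioo (0 : ℝ) 1 • (Subtype.val '' s))]
  congr 1
  ext x
  simp only [Set.mem_neg, Set.mem_smul, Set.mem_image, Set.mem_preimage]
  constructor
  · rintro ⟨r, hr, _, ⟨ω, hω, rfl⟩, rfl⟩
    exact ⟨r, hr, _, ⟨-ω, hω, rfl⟩, by simp⟩
  · rintro ⟨r, hr, _, ⟨ω, hω, rfl⟩, h⟩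
    refine ⟨r, hr, _, ⟨-ω, by simpa using hω, rfl⟩, ?_⟩
    rw [← neg_neg x, ← h]
    simp

/-- The phase space of a collision; `q = ((x, v, w), ω)`. -/
abbrev Coll (d : ℕ) : Type := (Torus d × Vel d × Vel d) × Sph d

/-- The Liouville measure `dx dv dw dω` of the collisions. -/
abbrev collMeasure (d : ℕ) : Measure (Coll d) :=
  (volume : Measure (Torus d × Vel d × Vel d)).prod (surf d)

/-- The outgoing and the incoming positions of the two particles of a collision:
`z₁'`, `z₂'`, `z₁`, `z₂`. -/
def particle (i : Fin 4) (q : Coll d) : Phase d :=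
  ![(q.1.1, scatV q.1.2.1 q.1.2.2 q.2), (q.1.1, scatW q.1.2.1 q.1.2.2 q.2), (q.1.1, q.1.2.1),
    (q.1.1, q.1.2.2)] i

/-- The hard-sphere cross section as a function of the collision. -/
def crossSection (q : Coll d) : ℝ := kernel q.1.2.1 q.1.2.2 q.2

/-- Twice the kinetic energy of a collision. -/
def energy (q : Coll d) : ℝ := ‖q.1.2.1‖ ^ 2 + ‖q.1.2.2‖ ^ 2

/-- The exchange of the two particles. -/
def exchange (q : Coll d) : Coll d := ((q.1.1, q.1.2.2, q.1.2.1), -q.2)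

/-- The exchange of incoming and outgoing velocities. -/
def reverse (q : Coll d) : Coll d :=
  ((q.1.1, scatV q.1.2.1 q.1.2.2 q.2, scatW q.1.2.1 q.1.2.2 q.2), -q.2)

theorem continuous_scatV : Continuous fun p : (Vel d × Vel d) × Sph d => scatV p.1.1 p.1.2 p.2 := by
  unfold scatV; fun_prop

theorem continuous_scatW : Continuous fun p : (Vel d × Vel d) × Sph d => scatW p.1.1 p.1.2 p.2 := by
  unfold scatW; fun_prop

@[fun_prop]
theorem measurable_scatV {α : Type*} [MeasurableSpace α] {v w : α → Vel d} {ω : α → Sph d}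
    (hv : Measurable v) (hw : Measurable w) (hω : Measurable ω) :
    Measurable fun a => scatV (v a) (w a) (ω a) :=
  continuous_scatV.measurable.comp ((hv.prodMk hw).prodMk hω)

@[fun_prop]
theorem measurable_scatW {α : Type*} [MeasurableSpace α] {v w : α → Vel d} {ω : α → Sph d}
    (hv : Measurable v) (hw : Measurable w) (hω : Measurable ω) :
    Measurable fun a => scatW (v a) (w a) (ω a) :=
  continuous_scatW.measurable.comp ((hv.prodMk hw).prodMk hω)

@[fun_prop]
theorem measurable_kernel {α : Type*} [MeasurableSpace α] {v w : α → Vel d} {ω : α → Sph d}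
    (hv : Measurable v) (hw : Measurable w) (hω : Measurable ω) :
    Measurable fun a => kernel (v a) (w a) (ω a) :=
  ((hv.sub hw).inner (continuous_subtype_val.measurable.comp hω)).max measurable_const

theorem measurable_crossSection : Measurable (crossSection : Coll d → ℝ) := by
  unfold crossSection; fun_prop

theorem measurable_energy : Measurable (energy : Coll d → ℝ) := by
  unfold energy; fun_prop

theorem measurable_particle (i : Fin 4) : Measurable (particle i : Coll d → Phase d) := by
  fin_cases i
  · exact Measurable.prodMk (by fun_prop)
      (measurable_scatV (by fun_prop) (by fun_prop) (by fun_prop))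
  · exact Measurable.prodMk (by fun_prop)
      (measurable_scatW (by fun_prop) (by fun_prop) (by fun_prop))
  · exact Measurable.prodMk (by fun_prop) (by fun_prop)
  · exact Measurable.prodMk (by fun_prop) (by fun_prop)

theorem norm_sph (ω : Sph d) : ‖(ω : Vel d)‖ = 1 := norm_eq_of_mem_sphere ω

theorem inner_scat (v w : Vel d) (ω : Sph d) :
    inner ℝ (scatV v w ω - scatW v w ω) (ω : Vel d) = -inner ℝ (v - w) (ω : Vel d) := by
  have h : inner ℝ (ω : Vel d) (ω : Vel d) = (1 : ℝ) := by
    rw [real_inner_self_eq_norm_sq, norm_sph, one_pow]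
  simp only [scatV, scatW, inner_sub_left, inner_add_left, inner_smul_left, h]
  simp only [conj_trivial, mul_one]
  ring

theorem scatV_scat (v w : Vel d) (ω : Sph d) :
    scatV (scatV v w ω) (scatW v w ω) ω = v := by
  rw [scatV, inner_scat, scatV, neg_smul, sub_neg_eq_add, sub_add_cancel]

theorem scatW_scat (v w : Vel d) (ω : Sph d) :
    scatW (scatV v w ω) (scatW v w ω) ω = w := by
  rw [scatW, inner_scat, scatW, neg_smul, add_neg_cancel_right]

theorem scatV_neg (v w : Vel d) (ω : Sph d) : scatV v w (-ω) = scatV v w ω := by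
  simp [scatV]

theorem scatW_neg (v w : Vel d) (ω : Sph d) : scatW v w (-ω) = scatW v w ω := by
  simp [scatW]

theorem scatV_swap (v w : Vel d) (ω : Sph d) : scatV w v ω = scatW v w ω := by
  simp only [scatV, scatW, inner_sub_left, sub_smul]; abel

theorem scatW_swap (v w : Vel d) (ω : Sph d) : scatW w v ω = scatV v w ω := by
  simp only [scatV, scatW, inner_sub_left, sub_smul]; abel

/-- The cross section sees only one hemisphere. Both exchanging the particles and scattering them
change the sign of `(v - w) · ω`; the simultaneous flip of `ω` restores it, which is why `exchange`
and `reverse` contain `-ω`. -/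
theorem kernel_swap_neg (v w : Vel d) (ω : Sph d) : kernel w v (-ω) = kernel v w ω := by
  simp only [kernel]
  rw [← neg_sub v w]
  simp [-neg_sub]

theorem kernel_scat_neg (v w : Vel d) (ω : Sph d) :
    kernel (scatV v w ω) (scatW v w ω) (-ω) = kernel v w ω := by
  have h := inner_scat v w ω
  simp only [kernel]
  rw [show ((-ω : Sph d) : Vel d) = -(ω : Vel d) from rfl, inner_neg_right, h, neg_neg]

theorem norm_sq_scat (v w : Vel d) (ω : Sph d) :
    ‖scatV v w ω‖ ^ 2 + ‖scatW v w ω‖ ^ 2 = ‖v‖ ^ 2 + ‖w‖ ^ 2 := by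
  rw [scatV, scatW, norm_sub_sq_real, norm_add_sq_real]
  simp only [norm_smul, norm_sph, inner_smul_right, inner_sub_left, mul_one, Real.norm_eq_abs,
    sq_abs]
  ring

theorem kernel_nonneg (v w : Vel d) (ω : Sph d) : 0 ≤ kernel v w ω := le_max_right _ _

theorem kernel_le (v w : Vel d) (ω : Sph d) : kernel v w ω ≤ ‖v‖ + ‖w‖ := by
  refine max_le ?_ (by positivity)
  calc inner ℝ (v - w) (ω : Vel d) ≤ ‖v - w‖ * ‖(ω : Vel d)‖ := real_inner_le_norm _ _
    _ = ‖v - w‖ := by rw [norm_sph, mul_one]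
    _ ≤ _ := norm_sub_le _ _

theorem crossSection_nonneg (q : Coll d) : 0 ≤ crossSection q := kernel_nonneg _ _ _

theorem energy_nonneg (q : Coll d) : 0 ≤ energy q := by unfold energy; positivity

theorem crossSection_sq_le (q : Coll d) : crossSection q ^ 2 ≤ 2 * (1 + energy q) := by
  have h := kernel_le q.1.2.1 q.1.2.2 q.2
  have h0 := kernel_nonneg q.1.2.1 q.1.2.2 q.2
  calc crossSection q ^ 2 ≤ (‖q.1.2.1‖ + ‖q.1.2.2‖) ^ 2 := by unfold crossSection; gcongr
    _ ≤ 2 * energy q := by unfold energy; nlinarith [sq_nonneg (‖q.1.2.1‖ - ‖q.1.2.2‖)]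
    _ ≤ _ := by linarith

theorem crossSection_le (q : Coll d) : crossSection q ≤ 1 + energy q := by
  have h := kernel_le q.1.2.1 q.1.2.2 q.2
  unfold crossSection energy
  nlinarith [sq_nonneg (‖q.1.2.1‖ - 1), sq_nonneg (‖q.1.2.2‖ - 1), sq_nonneg (‖q.1.2.1‖ + ‖q.1.2.2‖)]

theorem energy_exchange (q : Coll d) : energy (exchange q) = energy q := by
  simp [energy, exchange, add_comm]

theorem energy_reverse (q : Coll d) : energy (reverse q) = energy q := norm_sq_scat _ _ _

theorem crossSection_exchange (q : Coll d) : crossSection (exchange q) = crossSection q :=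
  kernel_swap_neg _ _ _

theorem crossSection_reverse (q : Coll d) : crossSection (reverse q) = crossSection q :=
  kernel_scat_neg _ _ _

theorem particle_exchange (i : Fin 4) (q : Coll d) :
    particle i (exchange q) = particle (![1, 0, 3, 2] i) q := by
  fin_cases i
  · exact Prod.ext rfl ((scatV_neg _ _ _).trans (scatV_swap _ _ _))
  · exact Prod.ext rfl ((scatW_neg _ _ _).trans (scatW_swap _ _ _))
  · rfl
  · rfl

theorem particle_reverse (i : Fin 4) (q : Coll d) :
    particle i (reverse q) = particle (![2, 3, 0, 1] i) q := by
  fin_cases i <;> simp [particle, reverse, scatV_neg, scatW_neg, scatV_scat, scatW_scat]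

theorem measurePreserving_neg_sph : MeasurePreserving (fun ω : Sph d => -ω) (surf d) (surf d) :=
  ⟨continuous_neg.measurable, map_neg_toSphere _⟩

theorem measurePreserving_exchange :
    MeasurePreserving (exchange : Coll d → Coll d) (collMeasure d) (collMeasure d) :=
  ((MeasurePreserving.id (volume : Measure (Torus d))).prod
    (Measure.measurePreserving_swap (μ := (volume : Measure (Vel d)))
      (ν := (volume : Measure (Vel d))))).prod measurePreserving_neg_sph

/-- The scattering map with fixed impact parameter, as a linear map. -/
def scatLinear (ω : Sph d) : Vel d × Vel d →ₗ[ℝ] Vel d × Vel d where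
  toFun p := (scatV p.1 p.2 ω, scatW p.1 p.2 ω)
  map_add' p p' := by
    simp only [scatV, scatW, inner_sub_left, inner_add_left, Prod.fst_add, Prod.snd_add, sub_smul,
      add_smul, Prod.mk_add_mk, Prod.mk.injEq]
    constructor <;> abel
  map_smul' c p := by
    simp [scatV, scatW, inner_sub_left, inner_smul_left, smul_sub, smul_add, sub_smul, mul_smul]

/-- For fixed `ω` scattering is a linear involution, so its determinant is `1` or `-1` and it
preserves Lebesgue measure; no explicit matrix is needed. -/
theorem map_scatLinear (ω : Sph d) :
    Measure.map (scatLinear ω) (volume : Measure (Vel d × Vel d)) = volume := by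
  have hinv : scatLinear ω ∘ₗ scatLinear ω = LinearMap.id := by
    ext p <;> simp [scatLinear, scatV_scat, scatW_scat]
  have hdet : LinearMap.det (scatLinear ω) * LinearMap.det (scatLinear ω) = 1 := by
    rw [← LinearMap.det_comp, hinv, LinearMap.det_id]
  have h0 : LinearMap.det (scatLinear ω) ≠ 0 := fun h => by simp [h] at hdet
  have h1 : |(LinearMap.det (scatLinear ω))⁻¹| = 1 := by
    rcases mul_self_eq_one_iff.1 hdet with h | h <;> simp [h]
  have : (volume : Measure (Vel d × Vel d)).IsAddHaarMeasure :=
    Measure.prod.instIsAddHaarMeasure (volume : Measure (Vel d)) (volume : Measure (Vel d))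
  rw [Measure.map_linearMap_addHaar_eq_smul_addHaar _ h0, h1]
  simp

/-- With `ω` moved to the first factor, the reversal is a skew product: the antipodal map on the
base, and on each fibre the linear scattering map together with the identity in `x`. -/
theorem measurePreserving_reverse :
    MeasurePreserving (reverse : Coll d → Coll d) (collMeasure d) (collMeasure d) := by
  have h1 : MeasurePreserving (fun p : Sph d × (Torus d × Vel d × Vel d) =>
      (-p.1, (p.2.1, scatLinear p.1 p.2.2))) ((surf d).prod volume) ((surf d).prod volume) := by
    refine measurePreserving_neg_sph.skew_product
      (g := fun (ω : Sph d) (p : Torus d × Vel d × Vel d) => (p.1, scatLinear ω p.2)) ?_ ?_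
    · change Measurable fun p : Sph d × (Torus d × Vel d × Vel d) =>
        (p.2.1, scatV p.2.2.1 p.2.2.2 p.1, scatW p.2.2.1 p.2.2.2 p.1)
      fun_prop
    · refine Eventually.of_forall fun ω => ?_
      have hω : MeasurePreserving (scatLinear ω) (volume : Measure (Vel d × Vel d)) volume := by
        refine ⟨?_, map_scatLinear ω⟩
        change Measurable fun p : Vel d × Vel d => (scatV p.1 p.2 ω, scatW p.1 p.2 ω)
        fun_prop
      exact ((MeasurePreserving.id (volume : Measure (Torus d))).prod hω).map_eq
  exact Measure.measurePreserving_swap.comp (h1.comp Measure.measurePreserving_swap)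

theorem measurable_shift {α : Type*} [MeasurableSpace α] {τ : α → ℝ} {z : α → Phase d}
    (hτ : Measurable τ) (hz : Measurable z) : Measurable fun a => shift (τ a) (z a) := by
  unfold shift
  refine Measurable.prodMk (measurable_pi_lambda _ fun i => ?_) (by fun_prop)
  have h1 : Measurable fun a => (z a).1 i := by fun_prop
  have h2 : Measurable fun a => τ a * (z a).2 i := by fun_prop
  exact h1.add (AddCircle.measurable_mk'.comp h2)

theorem measurePreserving_shift (τ : ℝ) :
    MeasurePreserving (shift τ : Phase d → Phase d) volume volume := by
  have h1 : MeasurePreserving (fun p : Vel d × Torus d =>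
      (p.1, fun i => p.2 i + ((τ * p.1 i : ℝ) : UnitAddCircle)))
      ((volume : Measure (Vel d)).prod (volume : Measure (Torus d)))
      ((volume : Measure (Vel d)).prod (volume : Measure (Torus d))) := by
    refine (MeasurePreserving.id (volume : Measure (Vel d))).skew_product
      (g := fun (v : Vel d) (x : Torus d) => fun i => x i + ((τ * v i : ℝ) : UnitAddCircle)) ?_ ?_
    · have : Measurable fun p : Vel d × Torus d => (shift τ (p.2, p.1)).1 :=
        (measurable_shift measurable_const (by fun_prop)).fst
      exact this
    · refine Eventually.of_forall fun v => ?_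
      exact map_add_right_eq_self (volume : Measure (Torus d))
        (fun i => ((τ * v i : ℝ) : UnitAddCircle))
  exact Measure.measurePreserving_swap.comp (h1.comp Measure.measurePreserving_swap)

theorem shift_shift (σ τ : ℝ) (z : Phase d) : shift σ (shift τ z) = shift (σ + τ) z := by
  ext i
  · simp only [shift, add_assoc, ← AddCircle.coe_add]
    congr 2
    ring
  · rfl

theorem shift_zero (z : Phase d) : shift 0 z = z := by
  ext i <;> simp [shift]

/-- The reassociation `(z, (w, ω)) ↦ ((x, v, w), ω)`. -/
def toColl (p : Phase d × (Vel d × Sph d)) : Coll d := ((p.1.1, p.1.2, p.2.1), p.2.2)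

theorem measurable_toColl : Measurable (toColl : Phase d × (Vel d × Sph d) → Coll d) := by
  unfold toColl; fun_prop

theorem measurePreserving_toColl :
    MeasurePreserving (toColl : Phase d × (Vel d × Sph d) → Coll d)
      ((volume : Measure (Phase d)).prod ((volume : Measure (Vel d)).prod (surf d)))
      (collMeasure d) :=
  ((measurePreserving_prodAssoc (volume : Measure (Torus d)) (volume : Measure (Vel d))
    (volume : Measure (Vel d))).prod (MeasurePreserving.id (surf d))).comp
    (MeasurePreserving.symm _ (measurePreserving_prodAssoc (volume : Measure (Phase d))
      (volume : Measure (Vel d)) (surf d)))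

end

/-! ### Weighted `L²` bounds for the linearized collision operator. -/

section

variable {d : ℕ}

instance sigmaFinite_prod_surf : SigmaFinite ((volume : Measure (Vel d)).prod (surf d)) :=
  Measure.prod.instSigmaFinite

/-- The square of the norm of `L²_a`. -/
def wnorm (a : ℝ) (H : Phase d → ℝ≥0∞) : ℝ≥0∞ :=
  ∫⁻ z, ENNReal.ofReal (Real.exp (-(a / 2 * ‖z.2‖ ^ 2))) * H z ^ 2

/-- The weight `(1 + E) exp (- (a/2) E)`, where `E` is the energy. -/
def collWeight (a : ℝ) (q : Coll d) : ℝ := (1 + energy q) * Real.exp (-(a / 2 * energy q))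

/-- The mass of `exp (- (a/2) |w|²) dw dω`. -/
def gaussMass (d : ℕ) (a : ℝ) : ℝ≥0∞ :=
  ∫⁻ p : Vel d × Sph d, ENNReal.ofReal (Real.exp (-(a / 2 * ‖p.1‖ ^ 2)))
    ∂((volume : Measure (Vel d)).prod (surf d))

/-- The operator that bounds `linAdjoint`. -/
def absLin (g : Phase d → ℝ) (H : Phase d → ℝ≥0∞) (z : Phase d) : ℝ≥0∞ :=
  ∫⁻ p : Vel d × Sph d, ∑ i, ‖g (z.1, p.1) * kernel z.2 p.1 p.2‖ₑ * H (particle i (toColl (z, p)))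
    ∂((volume : Measure (Vel d)).prod (surf d))

/-- The operator that bounds the Duhamel integral of `linAdjoint` along the characteristics. -/
def absStep (f : ℝ → Phase d → ℝ) (t : ℝ) (G : ℝ → Phase d → ℝ≥0∞) (s : ℝ) (z : Phase d) : ℝ≥0∞ :=
  ∫⁻ σ in Ioc s t, absLin (f σ) (G σ) (shift (σ - s) z)

theorem measurable_collWeight (a : ℝ) : Measurable (collWeight a : Coll d → ℝ) := by
  have := measurable_energy (d := d)
  unfold collWeight; fun_prop

theorem integrable_gaussian {a : ℝ} (ha : 0 < a) :
    Integrable fun v : Vel d => Real.exp (-(a / 2 * ‖v‖ ^ 2)) := by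
  have h := (GaussianFourier.integrable_cexp_neg_mul_sq_norm_add (V := Vel d) (b := (a / 2 : ℝ))
    (by simpa using ha) 0 0).re
  refine h.congr (Eventually.of_forall fun v => ?_)
  have hv : Complex.exp (-((a / 2 : ℝ) : ℂ) * (‖v‖ : ℂ) ^ 2 + 0 * ((inner ℝ (0 : Vel d) v : ℝ) : ℂ))
      = ((Real.exp (-(a / 2 * ‖v‖ ^ 2)) : ℝ) : ℂ) := by
    push_cast; congr 1; ring
  dsimp only
  rw [hv]
  rfl

theorem gaussMass_lt_top {a : ℝ} (ha : 0 < a) : gaussMass d a < ∞ := by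
  have h2 := (integrable_gaussian (d := d) ha).mul_prod (integrable_const (μ := surf d) (1 : ℝ))
  have h3 := h2.lintegral_lt_top
  simpa [gaussMass] using h3

theorem wnorm_mono {a b : ℝ} (h : a ≤ b) (H : Phase d → ℝ≥0∞) : wnorm b H ≤ wnorm a H := by
  unfold wnorm
  gcongr

/-- The weight depends on the energy alone, hence is invariant under exchange and reversal, and
these two symmetries permute the four positions transitively. Post-collisional arguments thus cost
no more than `z₁`. -/
theorem lintegral_particle (a : ℝ) {H : Phase d → ℝ≥0∞} (hH : Measurable H) (i : Fin 4) :
    ∫⁻ q, ENNReal.ofReal (collWeight a q) * H (particle i q) ∂(collMeasure d)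
      = ∫⁻ q, ENNReal.ofReal (collWeight a q) * H (particle 2 q) ∂(collMeasure d) := by
  have hm : ∀ j, Measurable fun q : Coll d =>
      ENNReal.ofReal (collWeight a q) * H (particle j q) := fun j =>
    (measurable_collWeight a).ennreal_ofReal.mul (hH.comp (measurable_particle j))
  have he : ∀ j, ∫⁻ q, ENNReal.ofReal (collWeight a q) * H (particle (![1, 0, 3, 2] j) q)
      ∂(collMeasure d) = ∫⁻ q, ENNReal.ofReal (collWeight a q) * H (particle j q)
      ∂(collMeasure d) := by
    intro j
    rw [← measurePreserving_exchange.lintegral_comp (hm j)]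
    simp only [particle_exchange, collWeight, energy_exchange]
  have hr : ∀ j, ∫⁻ q, ENNReal.ofReal (collWeight a q) * H (particle (![2, 3, 0, 1] j) q)
      ∂(collMeasure d) = ∫⁻ q, ENNReal.ofReal (collWeight a q) * H (particle j q)
      ∂(collMeasure d) := by
    intro j
    rw [← measurePreserving_reverse.lintegral_comp (hm j)]
    simp only [particle_reverse, collWeight, energy_reverse]
  fin_cases i
  · exact hr 2
  · exact (hr 3).trans (he 2)
  · rfl
  · exact he 2

/-- After reduction to the position `z₁`, the part `β' - β` of the Gaussian absorbs `1 + E`. The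
rest factorizes: the factor in `v` is the weight of `L²_β`, and the factor in `w` has a mass bounded
uniformly because `β ≥ β₀/2`. -/
theorem lintegral_collWeight_le {β₀ β β' : ℝ} (h1 : β₀ / 2 ≤ β)
    (h2 : β < β') (h3 : β' ≤ β + β₀) {H : Phase d → ℝ≥0∞} (hH : Measurable H) (i : Fin 4) :
    ∫⁻ q, ENNReal.ofReal (collWeight β' q) * H (particle i q) ^ 2 ∂(collMeasure d)
      ≤ ENNReal.ofReal ((β₀ + 2) / (β' - β)) * gaussMass d (β₀ / 2) * wnorm β H := by
  have hβ₀ : 0 ≤ β₀ := by linarith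
  have hδ : 0 < β' - β := sub_pos.2 h2
  have hm : Measurable fun q : Coll d =>
      ENNReal.ofReal (collWeight β' q) * H (particle 2 q) ^ 2 :=
    (measurable_collWeight β').ennreal_ofReal.mul ((hH.comp (measurable_particle 2)).pow_const 2)
  rw [lintegral_particle β' (hH.pow_const 2) i, ← measurePreserving_toColl.lintegral_comp hm,
    lintegral_prod (fun p : Phase d × (Vel d × Sph d) =>
      ENNReal.ofReal (collWeight β' (toColl p)) * H (particle 2 (toColl p)) ^ 2)
      (hm.comp measurable_toColl).aemeasurable]
  have hpt : ∀ (z : Phase d) (p : Vel d × Sph d),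
      ENNReal.ofReal (collWeight β' (toColl (z, p))) * H (particle 2 (toColl (z, p))) ^ 2
      ≤ (ENNReal.ofReal ((β₀ + 2) / (β' - β)) *
        (ENNReal.ofReal (Real.exp (-(β / 2 * ‖z.2‖ ^ 2))) * H z ^ 2)) *
        ENNReal.ofReal (Real.exp (-(β₀ / 2 / 2 * ‖p.1‖ ^ 2))) := by
    intro z p
    have hp : particle 2 (toColl (z, p)) = z := rfl
    have hE : energy (toColl (z, p)) = ‖z.2‖ ^ 2 + ‖p.1‖ ^ 2 := rfl
    have hw : collWeight β' (toColl (z, p)) ≤ (β₀ + 2) / (β' - β) *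
        Real.exp (-(β / 2 * ‖z.2‖ ^ 2)) * Real.exp (-(β₀ / 2 / 2 * ‖p.1‖ ^ 2)) := by
      have h4 := one_add_mul_exp_le hδ (by linarith : β' - β ≤ β₀) (energy_nonneg (toColl (z, p)))
      calc collWeight β' (toColl (z, p))
          = (1 + energy (toColl (z, p))) * Real.exp (-((β' - β) / 2 * energy (toColl (z, p))))
            * Real.exp (-(β / 2 * energy (toColl (z, p)))) := by
              rw [collWeight, mul_assoc, ← Real.exp_add]; ring_nf
        _ ≤ (β₀ + 2) / (β' - β) * (Real.exp (-(β / 2 * ‖z.2‖ ^ 2)) *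
            Real.exp (-(β₀ / 2 / 2 * ‖p.1‖ ^ 2))) := by
              gcongr
              rw [hE, ← Real.exp_add]
              gcongr
              nlinarith [mul_le_mul_of_nonneg_right h1 (sq_nonneg ‖p.1‖)]
        _ = _ := by ring
    rw [hp]
    calc _ ≤ ENNReal.ofReal ((β₀ + 2) / (β' - β) *
        Real.exp (-(β / 2 * ‖z.2‖ ^ 2)) * Real.exp (-(β₀ / 2 / 2 * ‖p.1‖ ^ 2))) * H z ^ 2 := by
          gcongr
      _ = _ := by
          rw [ENNReal.ofReal_mul (by positivity), ENNReal.ofReal_mul (by positivity)]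
          ring
  calc _ ≤ ∫⁻ z : Phase d, ∫⁻ p : Vel d × Sph d, (ENNReal.ofReal ((β₀ + 2) / (β' - β)) *
        (ENNReal.ofReal (Real.exp (-(β / 2 * ‖z.2‖ ^ 2))) * H z ^ 2)) *
        ENNReal.ofReal (Real.exp (-(β₀ / 2 / 2 * ‖p.1‖ ^ 2)))
        ∂((volume : Measure (Vel d)).prod (surf d)) :=
        lintegral_mono fun z => lintegral_mono fun p => hpt z p
    _ = ∫⁻ z : Phase d, (ENNReal.ofReal ((β₀ + 2) / (β' - β)) *
        (ENNReal.ofReal (Real.exp (-(β / 2 * ‖z.2‖ ^ 2))) * H z ^ 2)) * gaussMass d (β₀ / 2) := by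
        refine lintegral_congr fun z => ?_
        rw [lintegral_const_mul _ (by fun_prop)]
        rfl
    _ = _ := by
        have hmz : Measurable fun z : Phase d =>
            ENNReal.ofReal (Real.exp (-(β / 2 * ‖z.2‖ ^ 2))) * H z ^ 2 := by fun_prop
        rw [lintegral_mul_const _ (hmz.const_mul _), lintegral_const_mul _ hmz, wnorm]
        ring

theorem measurable_absLin {α : Type*} [MeasurableSpace α] {g : α → Phase d → ℝ}
    (hg : Measurable fun p : α × Phase d => g p.1 p.2) {H : α → Phase d → ℝ≥0∞}
    (hH : Measurable fun p : α × Phase d => H p.1 p.2) {z : α → Phase d} (hz : Measurable z) :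
    Measurable fun a => absLin (g a) (H a) (z a) := by
  refine Measurable.lintegral_prod_right (f := fun (a : α) (p : Vel d × Sph d) =>
    ∑ i, ‖g a ((z a).1, p.1) * kernel (z a).2 p.1 p.2‖ₑ * H a (particle i (toColl (z a, p)))) ?_
  refine Finset.measurable_sum _ fun i _ => ?_
  have h1 : Measurable fun q : α × (Vel d × Sph d) => g q.1 ((z q.1).1, q.2.1) :=
    hg.comp (measurable_fst.prodMk ((hz.comp measurable_fst).fst.prodMk measurable_snd.fst))
  have h2 : Measurable fun q : α × (Vel d × Sph d) => kernel (z q.1).2 q.2.1 q.2.2 :=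
    measurable_kernel (hz.comp measurable_fst).snd measurable_snd.fst measurable_snd.snd
  have h3 : Measurable fun q : α × (Vel d × Sph d) => H q.1 (particle i (toColl (z q.1, q.2))) :=
    hH.comp (measurable_fst.prodMk ((measurable_particle i).comp
      (measurable_toColl.comp ((hz.comp measurable_fst).prodMk measurable_snd))))
  exact (h1.mul h2).enorm.mul h3

/-- The constant in the bounds for the linearized operator. -/
def linConst (d : ℕ) (β₀ M : ℝ) : ℝ :=
  32 * M ^ 2 * (β₀ + 2) * (gaussMass d (β₀ / 2)).toReal ^ 2

/-- Cauchy-Schwarz in `(w, ω)` uses half of the Gaussian of `g` for the finite mass. The other half,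
once squared, combines with the weight in `v` into a function of the energy, which is conserved, so
`lintegral_collWeight_le` applies to all four positions. The factor 32 is 2 from
`crossSection_sq_le`, 4 from `sum_four_sq_le` and 4 from the final sum over positions. -/
theorem wnorm_absLin_le {β₀ M β β' : ℝ} (hβ₀ : 0 < β₀) (hM : 0 ≤ M) (h1 : β₀ / 2 ≤ β) (h2 : β < β')
    (h3 : β' ≤ β + β₀) {g : Phase d → ℝ}
    (hgM : ∀ z, |g z| ≤ M * Real.exp (-(β' / 2 * ‖z.2‖ ^ 2)))
    {H : Phase d → ℝ≥0∞} (hH : Measurable H) :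
    wnorm β' (absLin g H) ≤ ENNReal.ofReal (linConst d β₀ M / (β' - β)) * wnorm β H := by
  have hδ : 0 < β' - β := sub_pos.2 h2
  have hgm := gaussMass_lt_top (d := d) (half_pos hβ₀)
  have hF : ∀ i, Measurable fun p : Phase d × (Vel d × Sph d) =>
      ENNReal.ofReal (collWeight β' (toColl p)) * H (particle i (toColl p)) ^ 2 := fun i =>
    ((measurable_collWeight β').comp measurable_toColl).ennreal_ofReal.mul
      ((hH.comp ((measurable_particle i).comp measurable_toColl)).pow_const 2)
  have hcs : ∀ z : Phase d, ENNReal.ofReal (Real.exp (-(β' / 2 * ‖z.2‖ ^ 2))) * absLin g H z ^ 2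
      ≤ gaussMass d (β₀ / 2) * (ENNReal.ofReal (8 * M ^ 2) * ∫⁻ p : Vel d × Sph d,
        ∑ i, ENNReal.ofReal (collWeight β' (toColl (z, p))) * H (particle i (toColl (z, p))) ^ 2
        ∂((volume : Measure (Vel d)).prod (surf d))) := by
    intro z
    have hHm : ∀ i, Measurable fun p : Vel d × Sph d => H (particle i (toColl (z, p))) := fun i =>
      hH.comp ((measurable_particle i).comp (measurable_toColl.comp measurable_prodMk_left))
    have hk : Measurable fun p : Vel d × Sph d => kernel z.2 p.1 p.2 := by
      exact measurable_kernel measurable_const measurable_fst measurable_snd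
    -- The exponent `β'/4` is half of the exponent `β'/2` that bounds `g`, so the product of the two
    -- factors dominates the integrand.
    have hc := lintegral_mul_sq_le ((volume : Measure (Vel d)).prod (surf d))
      (f := fun p => ENNReal.ofReal (Real.exp (-(β' / 4 * ‖p.1‖ ^ 2))))
      (g := fun p => ENNReal.ofReal (M * Real.exp (-(β' / 4 * ‖p.1‖ ^ 2)) * kernel z.2 p.1 p.2) *
        ∑ i, H (particle i (toColl (z, p)))) (by fun_prop) (Measurable.aemeasurable
        (Measurable.mul (by fun_prop) (Finset.measurable_sum _ fun i _ => hHm i)))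
    have hle : absLin g H z ≤ ∫⁻ p : Vel d × Sph d,
        ENNReal.ofReal (Real.exp (-(β' / 4 * ‖p.1‖ ^ 2))) *
        (ENNReal.ofReal (M * Real.exp (-(β' / 4 * ‖p.1‖ ^ 2)) * kernel z.2 p.1 p.2) *
        ∑ i, H (particle i (toColl (z, p)))) ∂((volume : Measure (Vel d)).prod (surf d)) := by
      refine lintegral_mono fun p => ?_
      dsimp only
      rw [← Finset.mul_sum, ← mul_assoc, ← ENNReal.ofReal_mul (Real.exp_nonneg _)]
      refine mul_le_mul_left ?_ _
      rw [Real.enorm_eq_ofReal_abs, abs_mul, abs_of_nonneg (kernel_nonneg _ _ _)]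
      refine ENNReal.ofReal_le_ofReal ?_
      calc |g (z.1, p.1)| * kernel z.2 p.1 p.2
          ≤ M * Real.exp (-(β' / 2 * ‖p.1‖ ^ 2)) * kernel z.2 p.1 p.2 := by
            exact mul_le_mul_of_nonneg_right (hgM _) (kernel_nonneg _ _ _)
        _ = _ := by
            rw [show -(β' / 2 * ‖p.1‖ ^ 2) = -(β' / 4 * ‖p.1‖ ^ 2) + -(β' / 4 * ‖p.1‖ ^ 2) by ring,
              Real.exp_add]
            ring
    have hf2 : ∫⁻ p : Vel d × Sph d, ENNReal.ofReal (Real.exp (-(β' / 4 * ‖p.1‖ ^ 2))) ^ 2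
        ∂((volume : Measure (Vel d)).prod (surf d)) ≤ gaussMass d (β₀ / 2) := by
      refine lintegral_mono fun p => ?_
      dsimp only
      rw [← ENNReal.ofReal_pow (Real.exp_nonneg _), ← Real.exp_nat_mul]
      gcongr
      push_cast
      nlinarith [mul_le_mul_of_nonneg_right (h1.trans h2.le) (sq_nonneg ‖p.1‖)]
    have hg2 : ∀ p : Vel d × Sph d, ENNReal.ofReal (Real.exp (-(β' / 2 * ‖z.2‖ ^ 2))) *
        (ENNReal.ofReal (M * Real.exp (-(β' / 4 * ‖p.1‖ ^ 2)) * kernel z.2 p.1 p.2) *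
        ∑ i, H (particle i (toColl (z, p)))) ^ 2 ≤ ENNReal.ofReal (8 * M ^ 2) *
        ∑ i, ENNReal.ofReal (collWeight β' (toColl (z, p))) * H (particle i (toColl (z, p))) ^ 2 := by
      intro p
      have hb : Real.exp (-(β' / 2 * ‖z.2‖ ^ 2)) *
          (M * Real.exp (-(β' / 4 * ‖p.1‖ ^ 2)) * kernel z.2 p.1 p.2) ^ 2
          ≤ 2 * M ^ 2 * collWeight β' (toColl (z, p)) := by
        have h5 := crossSection_sq_le (toColl (z, p))
        have h6 : crossSection (toColl (z, p)) = kernel z.2 p.1 p.2 := rfl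
        have hE : energy (toColl (z, p)) = ‖z.2‖ ^ 2 + ‖p.1‖ ^ 2 := rfl
        rw [h6] at h5
        calc _ = M ^ 2 * (Real.exp (-(β' / 2 * ‖z.2‖ ^ 2)) * Real.exp (-(β' / 4 * ‖p.1‖ ^ 2)) *
              Real.exp (-(β' / 4 * ‖p.1‖ ^ 2))) * kernel z.2 p.1 p.2 ^ 2 := by ring
          _ = M ^ 2 * Real.exp (-(β' / 2 * energy (toColl (z, p)))) * kernel z.2 p.1 p.2 ^ 2 := by
              rw [← Real.exp_add, ← Real.exp_add, hE]; ring_nf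
          _ ≤ M ^ 2 * Real.exp (-(β' / 2 * energy (toColl (z, p)))) *
              (2 * (1 + energy (toColl (z, p)))) := by gcongr
          _ = _ := by rw [collWeight]; ring
      rw [mul_pow, ← mul_assoc, ← ENNReal.ofReal_pow (by
        have := kernel_nonneg z.2 p.1 p.2; positivity), ← ENNReal.ofReal_mul (Real.exp_nonneg _),
        ← Finset.mul_sum, ← mul_assoc]
      calc _ ≤ ENNReal.ofReal (2 * M ^ 2 * collWeight β' (toColl (z, p))) *
            (4 * ∑ i, H (particle i (toColl (z, p))) ^ 2) := by
            gcongr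
            exact sum_four_sq_le _
        _ = _ := by
            rw [show (8 : ℝ) * M ^ 2 = 4 * (2 * M ^ 2) by ring, ENNReal.ofReal_mul (by positivity),
              ENNReal.ofReal_mul (p := 4) (by positivity)]
            simp only [ENNReal.ofReal_ofNat]
            ring
    calc _ ≤ ENNReal.ofReal (Real.exp (-(β' / 2 * ‖z.2‖ ^ 2))) * (gaussMass d (β₀ / 2) *
          ∫⁻ p : Vel d × Sph d,
          (ENNReal.ofReal (M * Real.exp (-(β' / 4 * ‖p.1‖ ^ 2)) * kernel z.2 p.1 p.2) *
          ∑ i, H (particle i (toColl (z, p)))) ^ 2 ∂((volume : Measure (Vel d)).prod (surf d))) := by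
          gcongr
          exact (pow_le_pow_left' hle 2).trans (hc.trans (by gcongr))
      _ = gaussMass d (β₀ / 2) * ∫⁻ p : Vel d × Sph d,
          ENNReal.ofReal (Real.exp (-(β' / 2 * ‖z.2‖ ^ 2))) *
          (ENNReal.ofReal (M * Real.exp (-(β' / 4 * ‖p.1‖ ^ 2)) * kernel z.2 p.1 p.2) *
          ∑ i, H (particle i (toColl (z, p)))) ^ 2 ∂((volume : Measure (Vel d)).prod (surf d)) := by
          rw [lintegral_const_mul]
          · ring
          · exact (Measurable.mul (by fun_prop)
              (Finset.measurable_sum _ fun i _ => hHm i)).pow_const 2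
      _ ≤ _ := by
          gcongr
          rw [← lintegral_const_mul]
          · exact lintegral_mono hg2
          · exact Finset.measurable_sum _ fun i _ => (hF i).comp measurable_prodMk_left
  have hFs : Measurable fun p : Phase d × (Vel d × Sph d) =>
      ∑ i, ENNReal.ofReal (collWeight β' (toColl p)) * H (particle i (toColl p)) ^ 2 :=
    Finset.measurable_sum _ fun i _ => hF i
  calc wnorm β' (absLin g H)
      ≤ ∫⁻ z : Phase d, gaussMass d (β₀ / 2) * (ENNReal.ofReal (8 * M ^ 2) * ∫⁻ p : Vel d × Sph d,
        ∑ i, ENNReal.ofReal (collWeight β' (toColl (z, p))) * H (particle i (toColl (z, p))) ^ 2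
        ∂((volume : Measure (Vel d)).prod (surf d))) := lintegral_mono hcs
    _ = gaussMass d (β₀ / 2) * (ENNReal.ofReal (8 * M ^ 2) *
        ∑ i, ∫⁻ q, ENNReal.ofReal (collWeight β' q) * H (particle i q) ^ 2 ∂(collMeasure d)) := by
        rw [lintegral_const_mul _ (hFs.lintegral_prod_right'.const_mul _),
          lintegral_const_mul _ hFs.lintegral_prod_right', ← lintegral_prod _ hFs.aemeasurable,
          lintegral_finsetSum _ fun i _ => hF i]
        congr 2
        refine Finset.sum_congr rfl fun i _ => ?_
        exact measurePreserving_toColl.lintegral_comp (f := fun q =>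
          ENNReal.ofReal (collWeight β' q) * H (particle i q) ^ 2)
          ((measurable_collWeight β').ennreal_ofReal.mul
            ((hH.comp (measurable_particle i)).pow_const 2))
    _ ≤ gaussMass d (β₀ / 2) * (ENNReal.ofReal (8 * M ^ 2) * ∑ _i : Fin 4,
        ENNReal.ofReal ((β₀ + 2) / (β' - β)) * gaussMass d (β₀ / 2) * wnorm β H) := by
        gcongr with i
        exact lintegral_collWeight_le h1 h2 h3 hH i
    _ = _ := by
        set m := (gaussMass d (β₀ / 2)).toReal with hm
        have hm0 : 0 ≤ m := ENNReal.toReal_nonneg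
        rw [← ENNReal.ofReal_toReal hgm.ne, linConst, ← hm]
        simp only [Finset.sum_const, Finset.card_univ, Fintype.card_fin, nsmul_eq_mul]
        rw [show ((4 : ℕ) : ℝ≥0∞) = ENNReal.ofReal 4 by simp, ← mul_assoc, ← mul_assoc, ← mul_assoc,
          ← mul_assoc]
        rw [← ENNReal.ofReal_mul (by positivity), ← ENNReal.ofReal_mul (by positivity),
          ← ENNReal.ofReal_mul (by positivity), ← ENNReal.ofReal_mul (by positivity)]
        congr 2
        ring

theorem wnorm_comp_shift (a τ : ℝ) {H : Phase d → ℝ≥0∞} (hH : Measurable H) :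
    wnorm a (fun z => H (shift τ z)) = wnorm a H := by
  have hm : Measurable fun z : Phase d =>
      ENNReal.ofReal (Real.exp (-(a / 2 * ‖z.2‖ ^ 2))) * H z ^ 2 := by fun_prop
  exact (measurePreserving_shift τ).lintegral_comp hm

theorem lintegral_rpow_neg_half {s t : ℝ} (h : s ≤ t) :
    ∫⁻ σ in Ioc s t, ENNReal.ofReal ((σ - s) ^ (-(1 / 4) : ℝ)) ^ 2
      = ENNReal.ofReal (2 * (t - s) ^ (1 / 2 : ℝ)) := by
  have h1 : ∀ σ ∈ Ioc s t, ENNReal.ofReal ((σ - s) ^ (-(1 / 4) : ℝ)) ^ 2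
      = ENNReal.ofReal ((σ - s) ^ (-(1 / 2) : ℝ)) := by
    intro σ hσ
    have h0 : 0 < σ - s := sub_pos.2 hσ.1
    rw [← ENNReal.ofReal_pow (by positivity), ← Real.rpow_natCast, ← Real.rpow_mul h0.le]
    norm_num
  rw [setLIntegral_congr_fun measurableSet_Ioc h1]
  have hi : IntervalIntegrable (fun σ : ℝ => (σ - s) ^ (-(1 / 2) : ℝ)) volume s t := by
    have := (intervalIntegral.intervalIntegrable_rpow' (a := 0) (b := t - s)
      (r := -(1 / 2)) (by norm_num)).comp_sub_right s
    simpa using this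
  rw [← ofReal_integral_eq_lintegral_ofReal
    ((intervalIntegrable_iff_integrableOn_Ioc_of_le h).1 hi)]
  · congr 1
    rw [← intervalIntegral.integral_of_le h,
      intervalIntegral.integral_comp_sub_right (fun x : ℝ => x ^ (-(1 / 2) : ℝ)), sub_self,
      integral_rpow (Or.inl (by norm_num))]
    norm_num
    ring
  · refine (ae_restrict_iff' measurableSet_Ioc).2 (Eventually.of_forall fun σ hσ => ?_)
    have h0 : 0 < σ - s := sub_pos.2 hσ.1
    exact (Real.rpow_pos_of_pos h0 _).le

theorem measurable_absStep {f : ℝ → Phase d → ℝ} (hf : Measurable fun p : ℝ × Phase d => f p.1 p.2)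
    {G : ℝ → Phase d → ℝ≥0∞} (hG : Measurable fun p : ℝ × Phase d => G p.1 p.2) (s : ℝ) :
    Measurable fun p : Phase d × ℝ => absLin (f p.2) (G p.2) (shift (p.2 - s) p.1) :=
  measurable_absLin (g := fun p : Phase d × ℝ => f p.2) (H := fun p : Phase d × ℝ => G p.2)
    (hf.comp (measurable_fst.snd.prodMk measurable_snd))
    (hG.comp (measurable_fst.snd.prodMk measurable_snd))
    (measurable_shift (measurable_snd.sub_const s) measurable_fst)

end

/-! ### The Duhamel integral in a scale of spaces with moving weight. -/

section

variable {d : ℕ}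

/-- The Cauchy-Schwarz inequality in time, with the weight `(σ - s)^(-1/2)`. -/
theorem wnorm_lintegral_le (a : ℝ) {s t : ℝ} (hst : s ≤ t) {X : Phase d → ℝ → ℝ≥0∞}
    (hX : Measurable fun p : Phase d × ℝ => X p.1 p.2) :
    wnorm a (fun z => ∫⁻ σ in Ioc s t, X z σ) ≤ ENNReal.ofReal (2 * (t - s) ^ (1 / 2 : ℝ)) *
      ∫⁻ σ in Ioc s t, (ENNReal.ofReal ((σ - s) ^ (-(1 / 4) : ℝ)))⁻¹ ^ 2 *
        wnorm a (fun z => X z σ) := by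
  set ρ : ℝ → ℝ≥0∞ := fun σ => ENNReal.ofReal ((σ - s) ^ (-(1 / 4) : ℝ)) with hρ
  have hρm : Measurable ρ := ((measurable_id.sub_const s).pow_const _).ennreal_ofReal
  have hρpos : ∀ σ ∈ Ioc s t, ρ σ ≠ 0 ∧ ρ σ ≠ ∞ := fun σ hσ =>
    ⟨by
      have := Real.rpow_pos_of_pos (sub_pos.2 hσ.1) (-(1 / 4) : ℝ)
      simpa [hρ] using this, ENNReal.ofReal_ne_top⟩
  have hXz : ∀ z, Measurable (X z) := fun z => hX.comp (measurable_prodMk_left (x := z))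
  have hXσ : ∀ σ, Measurable fun z => X z σ := fun σ => hX.comp (measurable_prodMk_right (y := σ))
  have hw : Measurable fun p : Phase d × ℝ =>
      ENNReal.ofReal (Real.exp (-(a / 2 * ‖p.1.2‖ ^ 2))) := by fun_prop
  have hXi : Measurable fun p : Phase d × ℝ => (ρ p.2)⁻¹ ^ 2 *
      (ENNReal.ofReal (Real.exp (-(a / 2 * ‖p.1.2‖ ^ 2))) * X p.1 p.2 ^ 2) :=
    ((hρm.comp measurable_snd).inv.pow_const 2).mul (hw.mul (hX.pow_const 2))
  have hstep : ∀ z, (∫⁻ σ in Ioc s t, X z σ) ^ 2 ≤ ENNReal.ofReal (2 * (t - s) ^ (1 / 2 : ℝ)) *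
      ∫⁻ σ in Ioc s t, ((ρ σ)⁻¹ * X z σ) ^ 2 := by
    intro z
    have h1 := lintegral_mul_sq_le (volume.restrict (Ioc s t)) (f := ρ)
      (g := fun σ => (ρ σ)⁻¹ * X z σ) hρm.aemeasurable (hρm.inv.mul (hXz z)).aemeasurable
    have h2 : ∫⁻ σ in Ioc s t, X z σ = ∫⁻ σ in Ioc s t, ρ σ * ((ρ σ)⁻¹ * X z σ) := by
      refine setLIntegral_congr_fun measurableSet_Ioc fun σ hσ => ?_
      rw [← mul_assoc, ENNReal.mul_inv_cancel (hρpos σ hσ).1 (hρpos σ hσ).2, one_mul]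
    rw [h2]
    refine h1.trans ?_
    rw [lintegral_rpow_neg_half hst]
  calc wnorm a (fun z => ∫⁻ σ in Ioc s t, X z σ)
      ≤ ∫⁻ z, ENNReal.ofReal (2 * (t - s) ^ (1 / 2 : ℝ)) * ∫⁻ σ in Ioc s t, (ρ σ)⁻¹ ^ 2 *
        (ENNReal.ofReal (Real.exp (-(a / 2 * ‖z.2‖ ^ 2))) * X z σ ^ 2) := by
        refine lintegral_mono fun z => ?_
        have h3 : ∫⁻ σ in Ioc s t, (ρ σ)⁻¹ ^ 2 *
            (ENNReal.ofReal (Real.exp (-(a / 2 * ‖z.2‖ ^ 2))) * X z σ ^ 2)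
            = ENNReal.ofReal (Real.exp (-(a / 2 * ‖z.2‖ ^ 2))) *
              ∫⁻ σ in Ioc s t, ((ρ σ)⁻¹ * X z σ) ^ 2 := by
          have hm : Measurable fun σ => ((ρ σ)⁻¹ * X z σ) ^ 2 := (hρm.inv.mul (hXz z)).pow_const 2
          rw [← lintegral_const_mul _ hm]
          refine lintegral_congr fun σ => ?_
          ring
        dsimp only
        rw [h3, mul_left_comm]
        exact mul_le_mul_right (hstep z) _
    _ = _ := by
        rw [lintegral_const_mul _ hXi.lintegral_prod_right', lintegral_lintegral_swap
          hXi.aemeasurable]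
        congr 1
        refine lintegral_congr fun σ => ?_
        have hm : Measurable fun z : Phase d =>
            ENNReal.ofReal (Real.exp (-(a / 2 * ‖z.2‖ ^ 2))) * X z σ ^ 2 :=
          Measurable.mul (by fun_prop) ((hXσ σ).pow_const 2)
        rw [wnorm, ← lintegral_const_mul _ hm]

/-- Between times `σ` and `s` the weight gains `κ (σ - s)`, so `absLin` costs `1 / (κ (σ - s))` in
squared norm. That is not integrable in `σ`, but Cauchy-Schwarz in time with density `(σ -
s)^(-1/2)` leaves the same integrable singularity in each of the two factors; each contributes `2
√t`, whence `4 t / κ`. The transport does not change the norm. -/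
theorem wnorm_absStep_le {β₀ M b κ t : ℝ} (hβ₀ : 0 < β₀) (hM : 0 ≤ M) (hb : β₀ / 2 ≤ b)
    (hκ : 0 < κ) (hbt : b + κ * t ≤ 7 * β₀ / 8) {f : ℝ → Phase d → ℝ}
    (hf : Measurable fun p : ℝ × Phase d => f p.1 p.2)
    (hfM : ∀ σ ∈ Icc 0 t, ∀ z, |f σ z| ≤ M * Real.exp (-(7 * β₀ / 8 / 2 * ‖z.2‖ ^ 2)))
    {G : ℝ → Phase d → ℝ≥0∞} (hG : Measurable fun p : ℝ × Phase d => G p.1 p.2) {A : ℝ≥0∞}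
    (hA : ∀ σ ∈ Icc 0 t, wnorm (b + κ * (t - σ)) (G σ) ≤ A) {s : ℝ} (hs : s ∈ Icc 0 t) :
    wnorm (b + κ * (t - s)) (absStep f t G s)
      ≤ ENNReal.ofReal (4 * linConst d β₀ M * t / κ) * A := by
  set ρ : ℝ → ℝ≥0∞ := fun σ => ENNReal.ofReal ((σ - s) ^ (-(1 / 4) : ℝ)) with hρ
  have ht : 0 ≤ t := hs.1.trans hs.2
  have hρm : Measurable ρ := ((measurable_id.sub_const s).pow_const _).ennreal_ofReal
  have hc : 0 ≤ linConst d β₀ M / κ := by unfold linConst; positivity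
  have hroot : ENNReal.ofReal (2 * (t - s) ^ (1 / 2 : ℝ)) ≤ ENNReal.ofReal (2 * t ^ (1 / 2 : ℝ)) := by
    have h1 := hs.1
    have := Real.rpow_le_rpow (sub_nonneg.2 hs.2) (by linarith : t - s ≤ t)
      (by norm_num : (0 : ℝ) ≤ 1 / 2)
    gcongr
  have hσb : ∀ σ ∈ Ioc s t, (ρ σ)⁻¹ ^ 2 * wnorm (b + κ * (t - s))
      (fun z => absLin (f σ) (G σ) (shift (σ - s) z))
      ≤ ENNReal.ofReal (linConst d β₀ M / κ) * A * ρ σ ^ 2 := by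
    intro σ hσ
    have hσ' : σ ∈ Icc 0 t := ⟨hs.1.trans hσ.1.le, hσ.2⟩
    have hpos : 0 < σ - s := sub_pos.2 hσ.1
    have hρ0 : ρ σ ≠ 0 := by
      have := Real.rpow_pos_of_pos hpos (-(1 / 4) : ℝ)
      simpa [hρ] using this
    have hGσ : Measurable (G σ) := hG.comp (measurable_prodMk_left (x := σ))
    have hm : Measurable (absLin (f σ) (G σ)) :=
      measurable_absLin (g := fun _ : Phase d => f σ) (H := fun _ : Phase d => G σ)
        (hf.comp (measurable_const.prodMk measurable_snd)) (hGσ.comp measurable_snd) measurable_id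
    have hle := wnorm_absLin_le (d := d) (β := b + κ * (t - σ)) (β' := b + κ * (t - s)) hβ₀ hM
      (by nlinarith [mul_nonneg hκ.le (sub_nonneg.2 hσ.2)]) (by nlinarith)
      (by nlinarith [mul_nonneg hκ.le hs.1, mul_nonneg hκ.le (sub_nonneg.2 hσ.2)])
      (fun z => (hfM σ hσ' z).trans (by
        gcongr
        nlinarith [mul_nonneg hκ.le hs.1])) hGσ
    -- One factor `ρ²` cancels the inverse weight from Cauchy-Schwarz; the other is the integrable
    -- remainder.
    have hρ4 : ENNReal.ofReal (σ - s)⁻¹ = ρ σ ^ 2 * ρ σ ^ 2 := by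
      rw [← pow_add, hρ, ← ENNReal.ofReal_pow (by positivity), ← Real.rpow_natCast,
        ← Real.rpow_mul hpos.le, ← Real.rpow_neg_one]
      norm_num
    have hinv : (ρ σ)⁻¹ ^ 2 * ρ σ ^ 2 = 1 := by
      rw [← mul_pow, ENNReal.inv_mul_cancel hρ0 ENNReal.ofReal_ne_top, one_pow]
    rw [wnorm_comp_shift _ _ hm]
    calc _ ≤ (ρ σ)⁻¹ ^ 2 * (ENNReal.ofReal (linConst d β₀ M / κ * (σ - s)⁻¹) * A) := by
          refine mul_le_mul_right (hle.trans ?_) _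
          rw [show b + κ * (t - s) - (b + κ * (t - σ)) = κ * (σ - s) by ring, div_mul_eq_div_div,
            div_eq_mul_inv (_ / κ)]
          exact mul_le_mul_right (hA σ hσ') _
      _ = ((ρ σ)⁻¹ ^ 2 * ρ σ ^ 2) * (ENNReal.ofReal (linConst d β₀ M / κ) * A * ρ σ ^ 2) := by
          rw [ENNReal.ofReal_mul hc, hρ4]
          ring
      _ = _ := by rw [hinv, one_mul]
  calc wnorm (b + κ * (t - s)) (absStep f t G s)
      ≤ ENNReal.ofReal (2 * (t - s) ^ (1 / 2 : ℝ)) * ∫⁻ σ in Ioc s t, (ρ σ)⁻¹ ^ 2 *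
        wnorm (b + κ * (t - s)) (fun z => absLin (f σ) (G σ) (shift (σ - s) z)) :=
        wnorm_lintegral_le _ hs.2 (measurable_absStep hf hG s)
    _ ≤ ENNReal.ofReal (2 * (t - s) ^ (1 / 2 : ℝ)) * ∫⁻ σ in Ioc s t,
        ENNReal.ofReal (linConst d β₀ M / κ) * A * ρ σ ^ 2 :=
        mul_le_mul_right (setLIntegral_mono' measurableSet_Ioc hσb) _
    _ ≤ ENNReal.ofReal (2 * t ^ (1 / 2 : ℝ)) * (ENNReal.ofReal (linConst d β₀ M / κ) * A *
        ENNReal.ofReal (2 * t ^ (1 / 2 : ℝ))) := by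
        rw [lintegral_const_mul _ (hρm.pow_const 2), lintegral_rpow_neg_half hs.2]
        gcongr
    _ = _ := by
        have htt : t ^ (1 / 2 : ℝ) * t ^ (1 / 2 : ℝ) = t := by
          rw [← Real.rpow_add_of_nonneg ht (by norm_num) (by norm_num)]; norm_num
        calc _ = (ENNReal.ofReal (2 * t ^ (1 / 2 : ℝ)) * ENNReal.ofReal (2 * t ^ (1 / 2 : ℝ))) *
              ENNReal.ofReal (linConst d β₀ M / κ) * A := by ring
          _ = _ := by
              rw [← ENNReal.ofReal_mul (by positivity), ← ENNReal.ofReal_mul (by positivity),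
                show 2 * t ^ (1 / 2 : ℝ) * (2 * t ^ (1 / 2 : ℝ)) * (linConst d β₀ M / κ)
                = 4 * linConst d β₀ M * (t ^ (1 / 2 : ℝ) * t ^ (1 / 2 : ℝ)) / κ by ring, htt]

end

/-! ### Almost-everywhere consequences of the norm, and the Duhamel series. -/

section

variable {d : ℕ}

theorem measurable_weight (a : ℝ) :
    Measurable fun z : Phase d => ENNReal.ofReal (Real.exp (-(a / 2 * ‖z.2‖ ^ 2))) := by
  fun_prop

theorem ae_lt_top_of_wnorm {a : ℝ} {H : Phase d → ℝ≥0∞} (hH : Measurable H)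
    (h : wnorm a H ≠ ∞) : ∀ᵐ z, H z < ∞ := by
  have := ae_lt_top ((measurable_weight a).mul (hH.pow_const 2)) h
  filter_upwards [this] with z hz
  by_contra htop
  rw [not_lt, top_le_iff] at htop
  have h0 : ENNReal.ofReal (Real.exp (-(a / 2 * ‖z.2‖ ^ 2))) ≠ 0 := by simpa using Real.exp_pos _
  simp only [Pi.mul_apply] at hz
  rw [htop, ENNReal.top_pow two_ne_zero, ENNReal.mul_top h0] at hz
  exact lt_irrefl _ hz

theorem ae_eq_zero_of_wnorm {a : ℝ} {H : Phase d → ℝ≥0∞} (hH : Measurable H)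
    (h : wnorm a H = 0) : ∀ᵐ z, H z = 0 := by
  have := (lintegral_eq_zero_iff ((measurable_weight a).mul (hH.pow_const 2))).1 h
  filter_upwards [this] with z hz
  have h0 : ENNReal.ofReal (Real.exp (-(a / 2 * ‖z.2‖ ^ 2))) ≠ 0 := by simpa using Real.exp_pos _
  have h1 := (mul_eq_zero.1 hz).resolve_left h0
  simpa using h1

theorem wnorm_le_of_ae {a : ℝ} {H H' : Phase d → ℝ≥0∞} (h : ∀ᵐ z, H z ≤ H' z) :
    wnorm a H ≤ wnorm a H' := by
  refine lintegral_mono_ae ?_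
  filter_upwards [h] with z hz
  gcongr

theorem eLpNorm_weighted {a : ℝ} (ψ : Phase d → ℝ) (hψ : Measurable ψ) :
    eLpNorm ψ 2 (weighted d a) = wnorm a (fun z => ‖ψ z‖ₑ) ^ (1 / 2 : ℝ) := by
  rw [eLpNorm_eq_lintegral_rpow_enorm_toReal (by norm_num) (by norm_num)]
  simp only [ENNReal.toReal_ofNat, ENNReal.rpow_two]
  congr 1
  exact lintegral_withDensity_eq_lintegral_mul _ (measurable_weight a) (hψ.enorm.pow_const 2)

theorem weighted_ae {a : ℝ} {p : Phase d → Prop} :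
    (∀ᵐ z ∂(weighted d a), p z) ↔ ∀ᵐ z, p z := by
  rw [weighted, ae_withDensity_iff (measurable_weight a)]
  refine eventually_congr (Eventually.of_forall fun z => ?_)
  have h0 : ENNReal.ofReal (Real.exp (-(a / 2 * ‖z.2‖ ^ 2))) ≠ 0 := by simpa using Real.exp_pos _
  simp [h0]

theorem MemL2.exists_measurable {a : ℝ} {φ : Phase d → ℝ} (h : MemL2 a φ) :
    ∃ φ' : Phase d → ℝ, Measurable φ' ∧ φ =ᵐ[volume] φ' ∧ wnorm a (fun z => ‖φ' z‖ₑ) ≠ ∞ := by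
  obtain ⟨φ', hφ', hae⟩ := h.1
  refine ⟨φ', hφ'.measurable, weighted_ae.1 hae, fun htop => ?_⟩
  have h1 := h.2
  rw [eLpNorm_congr_ae hae, eLpNorm_weighted _ hφ'.measurable, htop] at h1
  simp at h1

/-- Cauchy-Schwarz against the sequence `2⁻ⁿ` bounds the squared sum by the sum of `4ⁿ U_n²`, and
`4ⁿ 8⁻ⁿ = 2⁻ⁿ` is still summable. -/
theorem wnorm_tsum_le {a : ℝ} {U : ℕ → Phase d → ℝ≥0∞} (hU : ∀ n, Measurable (U n)) {A : ℝ≥0∞}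
    (h : ∀ n, wnorm a (U n) ≤ (8⁻¹) ^ n * A) :
    wnorm a (fun z => ∑' n, U n z) ≤ (1 - 4⁻¹)⁻¹ * ((1 - 2⁻¹)⁻¹ * A) := by
  have h2 : ∀ n : ℕ, (2⁻¹ : ℝ≥0∞) ^ n * 2 ^ n = 1 := fun n => by
    rw [← mul_pow, ENNReal.inv_mul_cancel (by norm_num) (by norm_num), one_pow]
  have h4 : (2⁻¹ : ℝ≥0∞) ^ 2 = 4⁻¹ := by
    rw [← ENNReal.inv_pow]; norm_num
  have hcs : ∀ z, (∑' n, U n z) ^ 2 ≤ (1 - 4⁻¹)⁻¹ * ∑' n, (2 ^ n * U n z) ^ 2 := by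
    intro z
    have := lintegral_mul_sq_le (Measure.count : Measure ℕ) (f := fun n => (2⁻¹ : ℝ≥0∞) ^ n)
      (g := fun n => 2 ^ n * U n z) (measurable_of_countable _).aemeasurable
      (measurable_of_countable _).aemeasurable
    simp only [lintegral_count, ← mul_assoc, h2, one_mul] at this
    refine this.trans (le_of_eq ?_)
    congr 1
    simp_rw [← pow_mul, mul_comm _ 2, pow_mul, h4]
    rw [ENNReal.tsum_geometric]
  have hm : ∀ n, Measurable fun z : Phase d =>
      ENNReal.ofReal (Real.exp (-(a / 2 * ‖z.2‖ ^ 2))) * U n z ^ 2 := fun n =>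
    (measurable_weight a).mul ((hU n).pow_const 2)
  calc wnorm a (fun z => ∑' n, U n z)
      ≤ ∫⁻ z, (1 - 4⁻¹)⁻¹ * ∑' n, 4 ^ n *
        (ENNReal.ofReal (Real.exp (-(a / 2 * ‖z.2‖ ^ 2))) * U n z ^ 2) := by
        refine lintegral_mono fun z => ?_
        refine (mul_le_mul_right (hcs z) _).trans (le_of_eq ?_)
        rw [mul_left_comm, ← ENNReal.tsum_mul_left]
        congr 2
        ext n
        rw [mul_pow, ← pow_mul, mul_comm n 2, pow_mul, show (2 : ℝ≥0∞) ^ 2 = 4 by norm_num]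
        ring
    _ = (1 - 4⁻¹)⁻¹ * ∑' n, 4 ^ n * wnorm a (U n) := by
        rw [lintegral_const_mul _ (Measurable.tsum fun n => (hm n).const_mul _),
          lintegral_tsum fun n => ((hm n).const_mul _).aemeasurable]
        congr 2
        ext n
        exact lintegral_const_mul _ (hm n)
    _ ≤ (1 - 4⁻¹)⁻¹ * ∑' n, 2⁻¹ ^ n * A := by
        refine mul_le_mul_right (ENNReal.tsum_le_tsum fun n => ?_) _
        refine (mul_le_mul_right (h n) _).trans (le_of_eq ?_)
        rw [← mul_assoc, ← mul_pow]
        congr 2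
        rw [show (8 : ℝ≥0∞) = 4 * 2 by norm_num, ENNReal.mul_inv (by simp) (by simp), ← mul_assoc,
          ENNReal.mul_inv_cancel (by norm_num) (by norm_num), one_mul]
    _ = _ := by
        rw [ENNReal.tsum_mul_right, ENNReal.tsum_geometric]

/-- The signs of the four terms of `collDiff`. -/
def collSign (i : Fin 4) : ℝ := ![1, 1, -1, -1] i

theorem collDiff_eq_sum (ψ : Phase d → ℝ) (q : Coll d) :
    collDiff ψ q.1.1 q.1.2.1 q.1.2.2 q.2 = ∑ i, collSign i * ψ (particle i q) := by
  simp only [Fin.sum_univ_four, collSign, particle, collDiff]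
  simp
  ring

theorem enorm_collSign (i : Fin 4) : ‖collSign i‖ₑ = 1 := by
  fin_cases i <;> simp [collSign]

theorem linAdjoint_integrand_eq (g ψ : Phase d → ℝ) (z : Phase d) (p : Vel d × Sph d) :
    g (z.1, p.1) * collDiff ψ z.1 z.2 p.1 p.2 * kernel z.2 p.1 p.2
      = ∑ i, collSign i * (g (z.1, p.1) * kernel z.2 p.1 p.2) * ψ (particle i (toColl (z, p))) := by
  have h := collDiff_eq_sum ψ (toColl (z, p))
  change collDiff ψ z.1 z.2 p.1 p.2 = _ at h
  rw [h, Finset.mul_sum, Finset.sum_mul]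
  exact Finset.sum_congr rfl fun i _ => by ring

theorem enorm_linAdjoint_integrand_le (g ψ : Phase d → ℝ) (z : Phase d) (p : Vel d × Sph d) :
    ‖g (z.1, p.1) * collDiff ψ z.1 z.2 p.1 p.2 * kernel z.2 p.1 p.2‖ₑ
      ≤ ∑ i, ‖g (z.1, p.1) * kernel z.2 p.1 p.2‖ₑ * ‖ψ (particle i (toColl (z, p)))‖ₑ := by
  rw [linAdjoint_integrand_eq]
  refine (enorm_sum_le _ _).trans (le_of_eq (Finset.sum_congr rfl fun i _ => ?_))
  rw [enorm_mul, enorm_mul, enorm_collSign, one_mul]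

theorem enorm_linAdjoint_le (g ψ : Phase d → ℝ) (z : Phase d) :
    ‖linAdjoint g ψ z‖ₑ ≤ absLin g (fun z => ‖ψ z‖ₑ) z :=
  (enorm_integral_le_lintegral_enorm _).trans
    (lintegral_mono fun p => enorm_linAdjoint_integrand_le g ψ z p)

theorem measurable_linAdjoint_integrand {α : Type*} [MeasurableSpace α] {g ψ : α → Phase d → ℝ}
    (hg : Measurable fun p : α × Phase d => g p.1 p.2)
    (hψ : Measurable fun p : α × Phase d => ψ p.1 p.2) {z : α → Phase d} (hz : Measurable z) :
    Measurable fun q : α × (Vel d × Sph d) => g q.1 ((z q.1).1, q.2.1) *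
      collDiff (ψ q.1) (z q.1).1 (z q.1).2 q.2.1 q.2.2 * kernel (z q.1).2 q.2.1 q.2.2 := by
  simp_rw [linAdjoint_integrand_eq]
  have h1 : Measurable fun q : α × (Vel d × Sph d) => g q.1 ((z q.1).1, q.2.1) :=
    hg.comp (measurable_fst.prodMk ((hz.comp measurable_fst).fst.prodMk measurable_snd.fst))
  have h2 : Measurable fun q : α × (Vel d × Sph d) => kernel (z q.1).2 q.2.1 q.2.2 :=
    measurable_kernel (hz.comp measurable_fst).snd measurable_snd.fst measurable_snd.snd
  refine Finset.measurable_sum _ fun i _ => ((h1.mul h2).const_mul _).mul ?_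
  exact hψ.comp (measurable_fst.prodMk ((measurable_particle i).comp
    (measurable_toColl.comp ((hz.comp measurable_fst).prodMk measurable_snd))))

theorem measurable_linAdjoint {α : Type*} [MeasurableSpace α] {g ψ : α → Phase d → ℝ}
    (hg : Measurable fun p : α × Phase d => g p.1 p.2)
    (hψ : Measurable fun p : α × Phase d => ψ p.1 p.2) {z : α → Phase d} (hz : Measurable z) :
    Measurable fun a => linAdjoint (g a) (ψ a) (z a) :=
  ((measurable_linAdjoint_integrand hg hψ hz).stronglyMeasurable.integral_prod_right').measurable

theorem integrable_linAdjoint_integrand {g ψ : Phase d → ℝ} (hg : Measurable g) (hψ : Measurable ψ)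
    {z : Phase d} (h : absLin g (fun z => ‖ψ z‖ₑ) z < ∞) :
    Integrable (fun p : Vel d × Sph d =>
      g (z.1, p.1) * collDiff ψ z.1 z.2 p.1 p.2 * kernel z.2 p.1 p.2)
      ((volume : Measure (Vel d)).prod (surf d)) := by
  refine ⟨Measurable.aestronglyMeasurable ?_, ?_⟩
  · have := measurable_linAdjoint_integrand (α := Unit) (g := fun _ => g) (ψ := fun _ => ψ)
      (z := fun _ => z) (hg.comp measurable_snd) (hψ.comp measurable_snd) measurable_const
    exact this.comp (measurable_const.prodMk measurable_id (f := fun _ => ()))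
  · exact (lintegral_mono fun p => enorm_linAdjoint_integrand_le g ψ z p).trans_lt h

theorem linAdjoint_sub {g ψ₁ ψ₂ : Phase d → ℝ} (hg : Measurable g) (h₁ : Measurable ψ₁)
    (h₂ : Measurable ψ₂) {z : Phase d} (hf₁ : absLin g (fun z => ‖ψ₁ z‖ₑ) z < ∞)
    (hf₂ : absLin g (fun z => ‖ψ₂ z‖ₑ) z < ∞) :
    linAdjoint g ψ₁ z - linAdjoint g ψ₂ z = linAdjoint g (fun z => ψ₁ z - ψ₂ z) z := by
  rw [linAdjoint, linAdjoint, ← integral_sub (integrable_linAdjoint_integrand hg h₁ hf₁)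
    (integrable_linAdjoint_integrand hg h₂ hf₂), linAdjoint]
  refine integral_congr_ae (Eventually.of_forall fun p => ?_)
  simp only [collDiff]
  ring

section Duhamel

variable {f : ℝ → Phase d → ℝ} {Ψ : ℝ → Phase d → ℝ}

theorem measurable_linAdjoint_shift (hf : Measurable fun p : ℝ × Phase d => f p.1 p.2)
    (hΨ : Measurable fun p : ℝ × Phase d => Ψ p.1 p.2) (s : ℝ) :
    Measurable fun p : Phase d × ℝ => linAdjoint (f p.2) (Ψ p.2) (shift (p.2 - s) p.1) :=
  measurable_linAdjoint (g := fun p : Phase d × ℝ => f p.2) (ψ := fun p : Phase d × ℝ => Ψ p.2)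
    (hf.comp (measurable_fst.snd.prodMk measurable_snd))
    (hΨ.comp (measurable_fst.snd.prodMk measurable_snd))
    (measurable_shift (measurable_snd.sub_const s) measurable_fst)

theorem integrableOn_linAdjoint (hf : Measurable fun p : ℝ × Phase d => f p.1 p.2)
    (hΨ : Measurable fun p : ℝ × Phase d => Ψ p.1 p.2) {s t : ℝ} {z : Phase d}
    (h : absStep f t (fun σ z => ‖Ψ σ z‖ₑ) s z < ∞) :
    IntegrableOn (fun σ => linAdjoint (f σ) (Ψ σ) (shift (σ - s) z)) (Ioc s t) := by
  refine ⟨Measurable.aestronglyMeasurable ?_, ?_⟩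
  · have := (measurable_linAdjoint_shift hf hΨ s).comp (measurable_prodMk_left (x := z))
    exact this
  · exact (lintegral_mono fun σ => enorm_linAdjoint_le _ _ _).trans_lt h

/-- Finiteness of both majorants is what permits subtracting under the time integral and, for almost
every `σ`, under the collision integral. -/
theorem enorm_duhamel_sub_le {Ψ₁ Ψ₂ : ℝ → Phase d → ℝ}
    (hf : Measurable fun p : ℝ × Phase d => f p.1 p.2)
    (h₁ : Measurable fun p : ℝ × Phase d => Ψ₁ p.1 p.2)
    (h₂ : Measurable fun p : ℝ × Phase d => Ψ₂ p.1 p.2) {s t : ℝ} (hst : s ≤ t) {z : Phase d}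
    (hf₁ : absStep f t (fun σ z => ‖Ψ₁ σ z‖ₑ) s z < ∞)
    (hf₂ : absStep f t (fun σ z => ‖Ψ₂ σ z‖ₑ) s z < ∞) :
    ‖(∫ σ in s..t, linAdjoint (f σ) (Ψ₁ σ) (shift (σ - s) z))
      - ∫ σ in s..t, linAdjoint (f σ) (Ψ₂ σ) (shift (σ - s) z)‖ₑ
      ≤ absStep f t (fun σ z => ‖Ψ₁ σ z - Ψ₂ σ z‖ₑ) s z := by
  rw [intervalIntegral.integral_of_le hst, intervalIntegral.integral_of_le hst,
    ← integral_sub (integrableOn_linAdjoint hf h₁ hf₁) (integrableOn_linAdjoint hf h₂ hf₂)]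
  refine (enorm_integral_le_lintegral_enorm _).trans (lintegral_mono_ae ?_)
  have hm : ∀ {Ψ : ℝ → Phase d → ℝ}, (Measurable fun p : ℝ × Phase d => Ψ p.1 p.2) →
      Measurable fun σ => absLin (f σ) (fun z => ‖Ψ σ z‖ₑ) (shift (σ - s) z) := by
    intro Ψ hΨ
    have := (measurable_absStep hf (G := fun σ z => ‖Ψ σ z‖ₑ) hΨ.enorm s).comp
      (measurable_prodMk_left (x := z))
    exact this
  have hσ : ∀ {Ψ : ℝ → Phase d → ℝ}, (Measurable fun p : ℝ × Phase d => Ψ p.1 p.2) →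
      ∀ σ, Measurable (Ψ σ) := fun hΨ σ => hΨ.comp (measurable_prodMk_left (x := σ))
  filter_upwards [ae_lt_top (hm h₁) hf₁.ne, ae_lt_top (hm h₂) hf₂.ne] with σ e₁ e₂
  rw [linAdjoint_sub (hσ hf σ) (hσ h₁ σ) (hσ h₂ σ) e₁ e₂]
  exact enorm_linAdjoint_le _ _ _

/-- The general Neumann series is applied on space-time, with integration over `(σ, w, ω)` and one
term for each of the four positions. This yields a jointly measurable candidate that solves the
equation at every point where the majorant converges. -/
theorem exists_duhamel_series (hf : Measurable fun p : ℝ × Phase d => f p.1 p.2) (t : ℝ)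
    {φ : Phase d → ℝ} (hφ : Measurable φ) :
    ∃ (U : ℕ → ℝ → Phase d → ℝ≥0∞) (Ψ : ℝ → Phase d → ℝ),
      (∀ n, Measurable fun p : ℝ × Phase d => U n p.1 p.2) ∧
      (Measurable fun p : ℝ × Phase d => Ψ p.1 p.2) ∧
      (∀ s, U 0 s = fun z => ‖φ (shift (t - s) z)‖ₑ) ∧
      (∀ n s, U (n + 1) s = absStep f t (U n) s) ∧
      (∀ s z, ‖Ψ s z‖ₑ ≤ ∑' n, U n s z) ∧
      (∀ s ≤ t, ∀ z, ∑' n, U n s z ≠ ∞ →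
        Ψ s z = φ (shift (t - s) z) + ∫ σ in s..t, linAdjoint (f σ) (Ψ σ) (shift (σ - s) z)) := by
  -- The indicator moves the variable interval `(s, t]` into the coefficient, so that the reference
  -- measure does not depend on the point.
  let a : Fin 4 → ℝ × Phase d → ℝ × (Vel d × Sph d) → ℝ := fun i p y =>
    (Ioc p.1 t).indicator (fun σ => collSign i * (f σ ((shift (σ - p.1) p.2).1, y.2.1) *
      kernel p.2.2 y.2.1 y.2.2)) y.1
  let π : Fin 4 → ℝ × Phase d → ℝ × (Vel d × Sph d) → ℝ × Phase d := fun i p y =>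
    (y.1, particle i (toColl (shift (y.1 - p.1) p.2, y.2)))
  have hsh : Measurable fun p : (ℝ × Phase d) × (ℝ × (Vel d × Sph d)) =>
      shift (p.2.1 - p.1.1) p.1.2 := measurable_shift (by fun_prop) (by fun_prop)
  have ha : ∀ i, Measurable fun p : (ℝ × Phase d) × (ℝ × (Vel d × Sph d)) => a i p.1 p.2 := by
    intro i
    have h1 : Measurable fun p : (ℝ × Phase d) × (ℝ × (Vel d × Sph d)) =>
        collSign i * (f p.2.1 ((shift (p.2.1 - p.1.1) p.1.2).1, p.2.2.1) *
      kernel p.1.2.2 p.2.2.1 p.2.2.2) := by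
      refine ((hf.comp (measurable_snd.fst.prodMk (hsh.fst.prodMk measurable_snd.snd.fst))).mul
        (measurable_kernel ?_ ?_ ?_)).const_mul _ <;> fun_prop
    have hset : MeasurableSet {p : (ℝ × Phase d) × (ℝ × (Vel d × Sph d)) |
        p.1.1 < p.2.1 ∧ p.2.1 ≤ t} :=
      (measurableSet_lt measurable_fst.fst measurable_snd.fst).inter
        (measurableSet_le measurable_snd.fst measurable_const)
    exact h1.indicator hset
  have hπ : ∀ i, Measurable fun p : (ℝ × Phase d) × (ℝ × (Vel d × Sph d)) => π i p.1 p.2 := by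
    intro i
    exact measurable_snd.fst.prodMk ((measurable_particle i).comp
      (measurable_toColl.comp (hsh.prodMk measurable_snd.snd)))
  have hh : Measurable fun p : ℝ × Phase d => φ (shift (t - p.1) p.2) :=
    hφ.comp (measurable_shift (by fun_prop) (by fun_prop))
  obtain ⟨U, Ψ, hU, hΨ, hU0, hU1, hΨU, heq⟩ := exists_neumann_series
    ((volume : Measure ℝ).prod ((volume : Measure (Vel d)).prod (surf d))) ha hπ hh
  have hstep : ∀ (V : ℝ × Phase d → ℝ≥0∞), Measurable V → ∀ s z,
      ∫⁻ y, ∑ i, ‖a i (s, z) y‖ₑ * V (π i (s, z) y)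
        ∂((volume : Measure ℝ).prod ((volume : Measure (Vel d)).prod (surf d)))
      = absStep f t (fun σ z => V (σ, z)) s z := by
    intro V hV s z
    rw [lintegral_prod]
    · rw [absStep, ← lintegral_indicator measurableSet_Ioc]
      refine lintegral_congr fun σ => ?_
      by_cases hσ : σ ∈ Ioc s t
      · rw [indicator_of_mem hσ]
        refine lintegral_congr fun p => Finset.sum_congr rfl fun i _ => ?_
        change ‖(Ioc s t).indicator _ σ‖ₑ * _ = _
        rw [indicator_of_mem hσ, enorm_mul, enorm_collSign, one_mul]
        rfl
      · rw [indicator_of_notMem hσ]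
        refine (lintegral_congr fun p => ?_).trans lintegral_zero
        refine Finset.sum_eq_zero fun i _ => ?_
        change ‖(Ioc s t).indicator _ σ‖ₑ * _ = _
        rw [indicator_of_notMem hσ, enorm_zero, zero_mul]
    · exact (Finset.measurable_sum _ fun i _ => ((ha i).comp measurable_prodMk_left).enorm.mul
        (hV.comp ((hπ i).comp measurable_prodMk_left))).aemeasurable
  refine ⟨fun n s z => U n (s, z), fun s z => Ψ (s, z), hU, hΨ, ?_, ?_, ?_, ?_⟩
  · intro s
    ext z
    change U 0 (s, z) = _
    rw [hU0]
  · intro n s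
    ext z
    change U (n + 1) (s, z) = _
    rw [hU1]
    exact hstep (U n) (hU n) s z
  · exact fun s z => hΨU (s, z)
  · intro s hs z hz
    obtain ⟨hfin, he⟩ := heq (s, z) hz
    change Ψ (s, z) = _
    rw [he]
    congr 1
    rw [intervalIntegral.integral_of_le hs, integral_prod, ← integral_indicator measurableSet_Ioc]
    · refine integral_congr_ae (Eventually.of_forall fun σ => ?_)
      by_cases hσ : σ ∈ Ioc s t
      · rw [indicator_of_mem hσ, linAdjoint]
        refine integral_congr_ae (Eventually.of_forall fun p => ?_)
        dsimp only
        rw [linAdjoint_integrand_eq]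
        refine Finset.sum_congr rfl fun i _ => ?_
        change (Ioc s t).indicator _ σ * _ = _
        rw [indicator_of_mem hσ]
        rfl
      · rw [indicator_of_notMem hσ]
        refine (integral_congr_ae (Eventually.of_forall fun p => ?_)).trans (integral_zero _ _)
        refine Finset.sum_eq_zero fun i _ => ?_
        change (Ioc s t).indicator _ σ * _ = _
        rw [indicator_of_notMem hσ, zero_mul]
    · refine ⟨(Finset.measurable_sum _ fun i _ => ((ha i).comp measurable_prodMk_left).mul
        (hΨ.comp ((hπ i).comp measurable_prodMk_left))).aestronglyMeasurable, ?_⟩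
      refine lt_of_le_of_lt (lintegral_mono fun y => ?_) hfin.lt_top
      refine (enorm_sum_le _ _).trans (le_of_eq (Finset.sum_congr rfl fun i _ => enorm_mul _ _))

end Duhamel

end

/-! ### Existence and uniqueness for the backward equation on short times. -/

section

variable {d : ℕ} {β₀ M T : ℝ} {f : ℝ → Phase d → ℝ}

theorem wnorm_add_le (a : ℝ) {G : Phase d → ℝ≥0∞} (hG : Measurable G) (G' : Phase d → ℝ≥0∞) :
    wnorm a (fun z => G z + G' z) ≤ 2 * (wnorm a G + wnorm a G') := by
  have m : Measurable fun z : Phase d =>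
      ENNReal.ofReal (Real.exp (-(a / 2 * ‖z.2‖ ^ 2))) * G z ^ 2 :=
    (measurable_weight a).mul (hG.pow_const 2)
  rw [wnorm, wnorm, wnorm, ← lintegral_add_left m, ← lintegral_const_mul' _ _ (by simp)]
  refine lintegral_mono fun z => ?_
  refine (mul_le_mul_right (add_sq_le_two_mul _ _) _).trans (le_of_eq ?_)
  ring

/-- On the time interval `[0, T]` the background `f` has a Gaussian bound with the exponent `7β₀/8`,
and `T` is short compared to the size of the linearized operator. -/
structure IsShortTime (β₀ M T : ℝ) (f : ℝ → Phase d → ℝ) : Prop where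
  β₀_pos : 0 < β₀
  M_nonneg : 0 ≤ M
  T_pos : 0 < T
  small : 256 * linConst d β₀ M * T ^ 2 ≤ β₀
  measurable : Measurable fun p : ℝ × Phase d => f p.1 p.2
  bound : ∀ σ ∈ Icc 0 T, ∀ z, |f σ z| ≤ M * Real.exp (-(7 * β₀ / 8 / 2 * ‖z.2‖ ^ 2))

theorem linConst_nonneg (d : ℕ) (hβ₀ : 0 < β₀) (M : ℝ) : 0 ≤ linConst d β₀ M := by
  unfold linConst; positivity

namespace IsShortTime

/-- The slope `β₀/(8T)` spends at most `β₀/8` of weight over the whole interval. The constant `4 K t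
/ κ` is then at most `32 K T² / β₀`, which `small` bounds by `1/8`. -/
theorem wnorm_absStep_le (H : IsShortTime β₀ M T f) {t : ℝ} (ht : t ≤ T) {b : ℝ}
    (hb : β₀ / 2 ≤ b) (hb' : b ≤ 3 * β₀ / 4) {G : ℝ → Phase d → ℝ≥0∞}
    (hG : Measurable fun p : ℝ × Phase d => G p.1 p.2) {A : ℝ≥0∞}
    (hA : ∀ σ ∈ Icc 0 t, wnorm (b + β₀ / (8 * T) * (t - σ)) (G σ) ≤ A) {s : ℝ} (hs : s ∈ Icc 0 t) :
    wnorm (b + β₀ / (8 * T) * (t - s)) (absStep f t G s) ≤ 8⁻¹ * A := by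
  have hT := H.T_pos
  have hβ := H.β₀_pos
  have ht0 : 0 ≤ t := hs.1.trans hs.2
  have hκt : β₀ / (8 * T) * t ≤ β₀ / 8 := by
    rw [div_mul_eq_mul_div, div_le_div_iff₀ (by positivity) (by norm_num)]
    nlinarith [mul_le_mul_of_nonneg_left ht hβ.le]
  refine (FluctuatingBoltzmann.wnorm_absStep_le hβ H.M_nonneg hb (by positivity) (by linarith)
    H.measurable (fun σ hσ => H.bound σ ⟨hσ.1, hσ.2.trans ht⟩) hG hA hs).trans ?_
  have hK := linConst_nonneg d hβ M
  rw [show (8⁻¹ : ℝ≥0∞) = ENNReal.ofReal (1 / 8) by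
    rw [one_div, ENNReal.ofReal_inv_of_pos (by norm_num)]; norm_num]
  refine mul_le_mul_left (ENNReal.ofReal_le_ofReal ?_) _
  rw [div_div_eq_mul_div, div_le_div_iff₀ hβ (by norm_num)]
  have h1 : linConst d β₀ M * T * t ≤ linConst d β₀ M * T * T := by gcongr
  nlinarith [H.small]

theorem wnorm_weight_le (H : IsShortTime β₀ M T f) {t s b : ℝ} (hst : s ≤ t)
    (G : Phase d → ℝ≥0∞) : wnorm (b + β₀ / (8 * T) * (t - s)) G ≤ wnorm b G := by
  have hT := H.T_pos
  have hβ := H.β₀_pos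
  apply wnorm_mono
  have := sub_nonneg.2 hst
  have : 0 ≤ β₀ / (8 * T) * (t - s) := by positivity
  linarith

/-- Starting from the weight `β₀/2`, the terms of the series decay like `8⁻ⁿ` in squared norm and
stay within weight `5β₀/8`. The sum is therefore finite almost everywhere and bounded in
`L²_{3β₀/4}`. -/
theorem exists_solution (H : IsShortTime β₀ M T f) {t : ℝ} (ht : t ∈ Icc 0 T) {φ : Phase d → ℝ}
    (hφ : MemL2 (β₀ / 2) φ) : ∃ Ψ, IsBackwardSolution β₀ f t φ Ψ := by
  have hT := H.T_pos
  have hβ := H.β₀_pos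
  obtain ⟨φ', hφ'm, hφφ', hφ'⟩ := hφ.exists_measurable
  obtain ⟨U, Ψ, hU, hΨ, hU0, hU1, hΨU, heq⟩ := exists_duhamel_series H.measurable t hφ'm
  set A := wnorm (β₀ / 2) (fun z => ‖φ' z‖ₑ) with hA
  have hUs : ∀ n s, Measurable (U n s) := fun n s => (hU n).comp (measurable_prodMk_left (x := s))
  have hUA : ∀ n, ∀ s ∈ Icc 0 t,
      wnorm (β₀ / 2 + β₀ / (8 * T) * (t - s)) (U n s) ≤ 8⁻¹ ^ n * A := by
    intro n
    induction n with
    | zero =>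
      intro s hs
      rw [hU0, pow_zero, one_mul]
      refine (H.wnorm_weight_le hs.2 _).trans (le_of_eq ?_)
      exact wnorm_comp_shift _ _ hφ'm.enorm
    | succ n ih =>
      intro s hs
      rw [hU1, pow_succ', mul_assoc]
      exact H.wnorm_absStep_le ht.2 le_rfl (by linarith) (hU n) ih hs
  have hGs : ∀ s ∈ Icc 0 t, wnorm (β₀ / 2 + β₀ / (8 * T) * (t - s)) (fun z => ∑' n, U n s z)
      ≤ (1 - 4⁻¹)⁻¹ * ((1 - 2⁻¹)⁻¹ * A) := fun s hs =>
    wnorm_tsum_le (fun n => hUs n s) fun n => hUA n s hs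
  have hfin : (1 - 4⁻¹)⁻¹ * ((1 - 2⁻¹)⁻¹ * A) ≠ ∞ := by
    refine ENNReal.mul_ne_top ?_ (ENNReal.mul_ne_top ?_ hφ')
    · exact ENNReal.inv_ne_top.2 (tsub_pos_of_lt (by simp)).ne'
    · exact ENNReal.inv_ne_top.2 (tsub_pos_of_lt (by simp)).ne'
  have hκ : ∀ s ∈ Icc 0 t, β₀ / 2 + β₀ / (8 * T) * (t - s) ≤ 3 * β₀ / 4 := by
    intro s hs
    have : β₀ / (8 * T) * (t - s) ≤ β₀ / (8 * T) * T := by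
      gcongr
      linarith [hs.1, ht.2]
    have h8 : β₀ / (8 * T) * T = β₀ / 8 := by field_simp
    linarith
  refine ⟨Ψ, hΨ, ?_, ?_⟩
  · refine ⟨(((1 - 4⁻¹)⁻¹ * ((1 - 2⁻¹)⁻¹ * A)) ^ (1 / 2 : ℝ)).toNNReal, fun s hs => ?_⟩
    have hΨs : Measurable (Ψ s) := hΨ.comp (measurable_prodMk_left (x := s))
    rw [eLpNorm_weighted _ hΨs, ENNReal.coe_toNNReal
      (ENNReal.rpow_ne_top_of_nonneg (by norm_num) hfin)]
    gcongr
    refine (wnorm_mono (hκ s hs) _).trans (le_trans ?_ (hGs s hs))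
    exact wnorm_le_of_ae (Eventually.of_forall fun z => hΨU s z)
  · intro s hs
    -- The series was built from a Borel representative of `φ`; the flow pulls null sets back to
    -- null sets, so the original datum can be restored.
    have h1 := (measurePreserving_shift (d := d) (t - s)).quasiMeasurePreserving.ae hφφ'
    filter_upwards [h1, ae_lt_top_of_wnorm (Measurable.tsum fun n => hUs n s)
      (ne_top_of_le_ne_top hfin (hGs s hs))] with z hz1 hz2
    rw [hz1]
    exact heq s hs.2 z hz2.ne

end IsShortTime

namespace IsBackwardSolution

variable {t : ℝ} {φ : Phase d → ℝ} {Ψ Ψ₁ Ψ₂ : ℝ → Phase d → ℝ}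

theorem measurable_apply (h : IsBackwardSolution β₀ f t φ Ψ) (s : ℝ) : Measurable (Ψ s) :=
  h.measurable.comp (measurable_prodMk_left (x := s))

theorem exists_wnorm_le (h : IsBackwardSolution β₀ f t φ Ψ) :
    ∃ A : ℝ≥0∞, A ≠ ∞ ∧ ∀ s ∈ Icc 0 t, wnorm (3 * β₀ / 4) (fun z => ‖Ψ s z‖ₑ) ≤ A := by
  obtain ⟨C, hC⟩ := h.bound
  refine ⟨(C : ℝ≥0∞) ^ 2, by simp, fun s hs => ?_⟩
  have h1 := hC s hs
  rw [eLpNorm_weighted _ (h.measurable_apply s)] at h1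
  calc _ = (wnorm (3 * β₀ / 4) (fun z => ‖Ψ s z‖ₑ) ^ (1 / 2 : ℝ)) ^ 2 := by
        rw [← ENNReal.rpow_natCast, ← ENNReal.rpow_mul]; norm_num
    _ ≤ _ := by gcongr

theorem ae_absStep_lt_top (h : IsBackwardSolution β₀ f t φ Ψ) (H : IsShortTime β₀ M T f)
    (ht : t ≤ T) {s : ℝ} (hs : s ∈ Icc 0 t) :
    ∀ᵐ z, absStep f t (fun σ z => ‖Ψ σ z‖ₑ) s z < ∞ := by
  obtain ⟨A, hA, hle⟩ := h.exists_wnorm_le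
  have hβ := H.β₀_pos
  have h1 := H.wnorm_absStep_le ht (b := 3 * β₀ / 4) (by linarith) le_rfl
    (G := fun σ z => ‖Ψ σ z‖ₑ) h.measurable.enorm
    (fun σ hσ => (H.wnorm_weight_le hσ.2 _).trans (hle σ hσ)) hs
  have h2 : Measurable fun p : Phase d × ℝ =>
      absLin (f p.2) (fun z => ‖Ψ p.2 z‖ₑ) (shift (p.2 - s) p.1) :=
    measurable_absStep H.measurable (G := fun σ z => ‖Ψ σ z‖ₑ) h.measurable.enorm s
  exact ae_lt_top_of_wnorm h2.lintegral_prod_right'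
    (ne_top_of_le_ne_top (ENNReal.mul_ne_top (by simp) hA) h1)

/-- The difference is dominated by its own Duhamel image. Iterating from the base weight `3β₀/4`,
the only one in which solutions are known to be bounded, gives a bound `8⁻ⁿ` times a constant for
every `n`, hence zero. -/
theorem unique (H : IsShortTime β₀ M T f) (ht : t ≤ T) (h₁ : IsBackwardSolution β₀ f t φ Ψ₁)
    (h₂ : IsBackwardSolution β₀ f t φ Ψ₂) {s : ℝ} (hs : s ∈ Icc 0 t) :
    ∀ᵐ z, Ψ₁ s z = Ψ₂ s z := by
  have hβ := H.β₀_pos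
  obtain ⟨A₁, hA₁, hle₁⟩ := h₁.exists_wnorm_le
  obtain ⟨A₂, hA₂, hle₂⟩ := h₂.exists_wnorm_le
  set G : ℝ → Phase d → ℝ≥0∞ := fun σ z => ‖Ψ₁ σ z - Ψ₂ σ z‖ₑ with hG
  have hGm : Measurable fun p : ℝ × Phase d => G p.1 p.2 := (h₁.measurable.sub h₂.measurable).enorm
  have hGs : ∀ s, Measurable (G s) := fun s => hGm.comp (measurable_prodMk_left (x := s))
  have hstep : ∀ s ∈ Icc 0 t, ∀ᵐ z, G s z ≤ absStep f t G s z := by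
    intro s hs
    filter_upwards [h₁.equation s hs, h₂.equation s hs, h₁.ae_absStep_lt_top H ht hs,
      h₂.ae_absStep_lt_top H ht hs] with z e₁ e₂ f₁ f₂
    have := enorm_duhamel_sub_le H.measurable h₁.measurable h₂.measurable hs.2 f₁ f₂
    simp only [hG]
    rw [e₁, e₂, add_sub_add_left_eq_sub]
    exact this
  have hB : ∀ s ∈ Icc 0 t, wnorm (3 * β₀ / 4 + β₀ / (8 * T) * (t - s)) (G s)
      ≤ 2 * (A₁ + A₂) := by
    intro s hs
    refine (H.wnorm_weight_le hs.2 _).trans ?_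
    refine (wnorm_le_of_ae (Eventually.of_forall fun z => enorm_sub_le)).trans
      ((wnorm_add_le _ (h₁.measurable_apply s).enorm _).trans ?_)
    gcongr
    · exact hle₁ s hs
    · exact hle₂ s hs
  have hiter : ∀ n : ℕ, ∀ s ∈ Icc 0 t, wnorm (3 * β₀ / 4 + β₀ / (8 * T) * (t - s)) (G s)
      ≤ 8⁻¹ ^ n * (2 * (A₁ + A₂)) := by
    intro n
    induction n with
    | zero => simpa using hB
    | succ n ih =>
      intro s hs
      refine (wnorm_le_of_ae (hstep s hs)).trans ?_
      rw [pow_succ', mul_assoc]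
      exact H.wnorm_absStep_le ht (by linarith) le_rfl hGm ih hs
  have hlim : Tendsto (fun n : ℕ => (8⁻¹ : ℝ≥0∞) ^ n * (2 * (A₁ + A₂))) atTop (𝓝 0) := by
    have := ENNReal.Tendsto.mul_const (b := 2 * (A₁ + A₂))
      (ENNReal.tendsto_pow_atTop_nhds_zero_of_lt_one (r := 8⁻¹) (by simp))
      (Or.inr (ENNReal.mul_ne_top (by simp) (ENNReal.add_ne_top.2 ⟨hA₁, hA₂⟩)))
    simpa using this
  have h0 : wnorm (3 * β₀ / 4 + β₀ / (8 * T) * (t - s)) (G s) = 0 :=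
    le_antisymm (ge_of_tendsto' hlim fun n => hiter n s hs) bot_le
  filter_upwards [ae_eq_zero_of_wnorm (hGs s) h0] with z hz
  exact sub_eq_zero.1 (by simpa [hG] using hz)

end IsBackwardSolution

end

/-! ### Pairings of two test functions over the space of collisions. -/

section

variable {d : ℕ} {β₀ M T : ℝ} {f : ℝ → Phase d → ℝ}

theorem _root_.MeasureTheory.MeasurePreserving.integral_comp_of_measurable {α β : Type*}
    [MeasurableSpace α] [MeasurableSpace β] {μ : Measure α} {ν : Measure β} {g : α → β}
    (hg : MeasurePreserving g μ ν) {F : β → ℝ} (hF : Measurable F) :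
    ∫ a, F (g a) ∂μ = ∫ b, F b ∂ν := by
  rw [← hg.map_eq, integral_map hg.measurable.aemeasurable hF.aestronglyMeasurable]

instance sigmaFinite_collMeasure : SigmaFinite (collMeasure d) := Measure.prod.instSigmaFinite

/-- `A` is bounded on `[0, s]` with values in `L²_a`. -/
structure IsBoundedL2 (a s : ℝ) (A : ℝ → Phase d → ℝ) : Prop where
  measurable : Measurable fun p : ℝ × Phase d => A p.1 p.2
  bound : ∃ C : ℝ≥0∞, C ≠ ∞ ∧ ∀ u ∈ Icc 0 s, wnorm a (fun z => ‖A u z‖ₑ) ≤ C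

/-- The density of the collisions that remove particles. -/
def lossDensity (g : Phase d → ℝ) (q : Coll d) : ℝ :=
  g (particle 2 q) * g (particle 3 q) * crossSection q

/-- The density of the collisions that create particles. -/
def gainDensity (g : Phase d → ℝ) (q : Coll d) : ℝ :=
  g (particle 0 q) * g (particle 1 q) * crossSection q

theorem lossDensity_exchange (g : Phase d → ℝ) (q : Coll d) :
    lossDensity g (exchange q) = lossDensity g q := by
  simp only [lossDensity, particle_exchange, crossSection_exchange]
  simp only [Fin.isValue, Matrix.cons_val]
  ring

theorem lossDensity_reverse (g : Phase d → ℝ) (q : Coll d) :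
    lossDensity g (reverse q) = gainDensity g q := by
  simp only [lossDensity, gainDensity, particle_reverse, crossSection_reverse]
  simp only [Fin.isValue, Matrix.cons_val]

theorem measurable_lossDensity (hf : Measurable fun p : ℝ × Phase d => f p.1 p.2) :
    Measurable fun p : ℝ × Coll d => lossDensity (f p.1) p.2 :=
  ((hf.comp (measurable_fst.prodMk ((measurable_particle 2).comp measurable_snd))).mul
    (hf.comp (measurable_fst.prodMk ((measurable_particle 3).comp measurable_snd)))).mul
    (measurable_crossSection.comp measurable_snd)

theorem measurable_gainDensity (hf : Measurable fun p : ℝ × Phase d => f p.1 p.2) :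
    Measurable fun p : ℝ × Coll d => gainDensity (f p.1) p.2 :=
  ((hf.comp (measurable_fst.prodMk ((measurable_particle 0).comp measurable_snd))).mul
    (hf.comp (measurable_fst.prodMk ((measurable_particle 1).comp measurable_snd)))).mul
    (measurable_crossSection.comp measurable_snd)

namespace IsShortTime

theorem abs_mul_mul_crossSection_le (H : IsShortTime β₀ M T f) {u : ℝ} (hu : u ∈ Icc 0 T)
    {z₁ z₂ : Phase d} {q : Coll d} (h : ‖z₁.2‖ ^ 2 + ‖z₂.2‖ ^ 2 = energy q) :
    |f u z₁ * f u z₂ * crossSection q| ≤ M ^ 2 * collWeight (7 * β₀ / 8) q := by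
  rw [abs_mul, abs_mul, abs_of_nonneg (crossSection_nonneg q)]
  have hM := H.M_nonneg
  have h0 := crossSection_nonneg q
  calc |f u z₁| * |f u z₂| * crossSection q
      ≤ (M * Real.exp (-(7 * β₀ / 8 / 2 * ‖z₁.2‖ ^ 2))) *
        (M * Real.exp (-(7 * β₀ / 8 / 2 * ‖z₂.2‖ ^ 2))) * (1 + energy q) := by
        gcongr
        · exact H.bound u hu z₁
        · exact H.bound u hu z₂
        · exact crossSection_le q
    _ = M ^ 2 * ((1 + energy q) * (Real.exp (-(7 * β₀ / 8 / 2 * ‖z₁.2‖ ^ 2)) *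
        Real.exp (-(7 * β₀ / 8 / 2 * ‖z₂.2‖ ^ 2)))) := by ring
    _ = _ := by rw [← Real.exp_add, collWeight, ← h]; ring_nf

theorem abs_lossDensity_le (H : IsShortTime β₀ M T f) {u : ℝ} (hu : u ∈ Icc 0 T) (q : Coll d) :
    |lossDensity (f u) q| ≤ M ^ 2 * collWeight (7 * β₀ / 8) q :=
  H.abs_mul_mul_crossSection_le hu rfl

theorem abs_gainDensity_le (H : IsShortTime β₀ M T f) {u : ℝ} (hu : u ∈ Icc 0 T) (q : Coll d) :
    |gainDensity (f u) q| ≤ M ^ 2 * collWeight (7 * β₀ / 8) q :=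
  H.abs_mul_mul_crossSection_le hu (norm_sq_scat _ _ _)

end IsShortTime

/-- The product `A B` is split as `A² + B²`, and each square is controlled at fixed time by the step
from weight `3β₀/4` to `7β₀/8`, uniformly on the bounded time interval. All absolute convergence of
collision integrals rests on this. -/
theorem integrable_pairing (hβ₀ : 0 < β₀) {s : ℝ} {c : ℝ → Coll d → ℝ}
    (hc : Measurable fun p : ℝ × Coll d => c p.1 p.2)
    (hcM : ∀ u ∈ Icc 0 s, ∀ q, |c u q| ≤ M ^ 2 * collWeight (7 * β₀ / 8) q)
    {A B : ℝ → Phase d → ℝ} (hA : IsBoundedL2 (3 * β₀ / 4) s A) (hB : IsBoundedL2 (3 * β₀ / 4) s B)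
    (i j : Fin 4) :
    Integrable (fun p : ℝ × Coll d => c p.1 p.2 * A p.1 (particle i p.2) * B p.1 (particle j p.2))
      ((volume.restrict (Ioc 0 s)).prod (collMeasure d)) := by
  obtain ⟨CA, hCA, hA'⟩ := hA.bound
  obtain ⟨CB, hCB, hB'⟩ := hB.bound
  have hp : ∀ {D : ℝ → Phase d → ℝ}, (Measurable fun p : ℝ × Phase d => D p.1 p.2) → ∀ k,
      Measurable fun p : ℝ × Coll d => D p.1 (particle k p.2) := fun hD k =>
    hD.comp (measurable_fst.prodMk ((measurable_particle k).comp measurable_snd))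
  have hm : Measurable fun p : ℝ × Coll d =>
      c p.1 p.2 * A p.1 (particle i p.2) * B p.1 (particle j p.2) :=
    (hc.mul (hp hA.measurable i)).mul (hp hB.measurable j)
  refine ⟨hm.aestronglyMeasurable, ?_⟩
  set L := ENNReal.ofReal ((β₀ + 2) / (7 * β₀ / 8 - 3 * β₀ / 4)) * gaussMass d (β₀ / 2) with hL
  have hLtop : L ≠ ∞ := ENNReal.mul_ne_top ENNReal.ofReal_ne_top
    (gaussMass_lt_top (half_pos hβ₀)).ne
  have hslice : ∀ u ∈ Ioc 0 s, ∫⁻ q, ‖c u q * A u (particle i q) * B u (particle j q)‖ₑ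
      ∂(collMeasure d) ≤ ENNReal.ofReal (M ^ 2) * (L * CA + L * CB) := by
    intro u hu
    have hu' : u ∈ Icc 0 s := ⟨hu.1.le, hu.2⟩
    have hAu : Measurable fun z => ‖A u z‖ₑ :=
      (hA.measurable.comp (measurable_prodMk_left (x := u))).enorm
    have hBu : Measurable fun z => ‖B u z‖ₑ :=
      (hB.measurable.comp (measurable_prodMk_left (x := u))).enorm
    have hw := (measurable_collWeight (d := d) (7 * β₀ / 8)).ennreal_ofReal
    have m1 : Measurable fun q => ENNReal.ofReal (collWeight (7 * β₀ / 8) q) *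
        ‖A u (particle i q)‖ₑ ^ 2 := hw.mul ((hAu.comp (measurable_particle i)).pow_const 2)
    calc _ ≤ ∫⁻ q, ENNReal.ofReal (M ^ 2) * (ENNReal.ofReal (collWeight (7 * β₀ / 8) q) *
          ‖A u (particle i q)‖ₑ ^ 2 + ENNReal.ofReal (collWeight (7 * β₀ / 8) q) *
          ‖B u (particle j q)‖ₑ ^ 2) ∂(collMeasure d) := by
          refine lintegral_mono fun q => ?_
          rw [enorm_mul, enorm_mul, mul_assoc, ← mul_add, ← mul_assoc (ENNReal.ofReal (M ^ 2)),
            ← ENNReal.ofReal_mul (sq_nonneg M), Real.enorm_eq_ofReal_abs (c u q)]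
          gcongr
          · exact hcM u hu' q
          · exact mul_le_sq_add_sq _ _
      _ ≤ _ := by
          rw [lintegral_const_mul' _ _ ENNReal.ofReal_ne_top, lintegral_add_left m1]
          gcongr
          · refine (lintegral_collWeight_le (β₀ := β₀) (β := 3 * β₀ / 4) (by linarith)
              (by linarith) (by linarith) hAu i).trans ?_
            gcongr
            exact hA' u hu'
          · refine (lintegral_collWeight_le (β₀ := β₀) (β := 3 * β₀ / 4) (by linarith)
              (by linarith) (by linarith) hBu j).trans ?_
            gcongr
            exact hB' u hu'
  rw [HasFiniteIntegral, lintegral_prod _ hm.enorm.aemeasurable]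
  refine (setLIntegral_mono' measurableSet_Ioc hslice).trans_lt ?_
  rw [setLIntegral_const, Real.volume_Ioc]
  exact ENNReal.mul_lt_top (ENNReal.mul_lt_top ENNReal.ofReal_lt_top (ENNReal.add_lt_top.2
    ⟨ENNReal.mul_lt_top hLtop.lt_top hCA.lt_top, ENNReal.mul_lt_top hLtop.lt_top hCB.lt_top⟩))
    ENNReal.ofReal_lt_top

/-- Integration over the second particle of a function on the space of collisions. -/
theorem integrable_integral_toColl {s : ℝ} {F : ℝ × Coll d → ℝ} (hFm : Measurable F)
    (hF : Integrable F ((volume.restrict (Ioc 0 s)).prod (collMeasure d))) :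
    Integrable (fun p : ℝ × Phase d => ∫ y, F (p.1, toColl (p.2, y))
      ∂((volume : Measure (Vel d)).prod (surf d))) ((volume.restrict (Ioc 0 s)).prod volume) ∧
    ∫ p : ℝ × Phase d, ∫ y, F (p.1, toColl (p.2, y)) ∂((volume : Measure (Vel d)).prod (surf d))
      ∂((volume.restrict (Ioc 0 s)).prod volume)
      = ∫ p, F p ∂((volume.restrict (Ioc 0 s)).prod (collMeasure d)) := by
  have hmp := ((MeasurePreserving.id (volume.restrict (Ioc 0 s))).prod
    (measurePreserving_toColl (d := d))).comp (measurePreserving_prodAssoc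
      (volume.restrict (Ioc 0 s)) (volume : Measure (Phase d))
      ((volume : Measure (Vel d)).prod (surf d)))
  have hi := hmp.integrable_comp_of_integrable hF
  refine ⟨hi.integral_prod_left, ?_⟩
  rw [← hmp.integral_comp_of_measurable hFm]
  exact (integral_prod _ hi).symm

/-- Integration over the impact parameter of a function on the space of collisions. -/
theorem integrable_integral_sph {s : ℝ} {F : ℝ × Coll d → ℝ} (hFm : Measurable F)
    (hF : Integrable F ((volume.restrict (Ioc 0 s)).prod (collMeasure d))) :
    Integrable (fun p : ℝ × (Torus d × Vel d × Vel d) => ∫ ω, F (p.1, (p.2, ω)) ∂(surf d))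
      ((volume.restrict (Ioc 0 s)).prod volume) ∧
    ∫ p : ℝ × (Torus d × Vel d × Vel d), ∫ ω, F (p.1, (p.2, ω)) ∂(surf d)
      ∂((volume.restrict (Ioc 0 s)).prod volume)
      = ∫ p, F p ∂((volume.restrict (Ioc 0 s)).prod (collMeasure d)) := by
  have hmp := measurePreserving_prodAssoc (volume.restrict (Ioc 0 s))
    (volume : Measure (Torus d × Vel d × Vel d)) (surf d)
  have hi := hmp.integrable_comp_of_integrable hF
  refine ⟨hi.integral_prod_left, ?_⟩
  rw [← hmp.integral_comp_of_measurable hFm]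
  exact (integral_prod _ hi).symm

section Pairing

variable {Ψ Φ : ℝ → Phase d → ℝ} {s : ℝ}

/-- The integrand `f(z₁) f(z₂) Ψ(zᵢ) Φ(zⱼ) ((v - w) · ω)₊`, where `zᵢ` and `zⱼ` are two of the four
positions of a collision. -/
def lossPairing (f Ψ Φ : ℝ → Phase d → ℝ) (i j : Fin 4) (p : ℝ × Coll d) : ℝ :=
  lossDensity (f p.1) p.2 * Ψ p.1 (particle i p.2) * Φ p.1 (particle j p.2)

/-- The analogue of `lossPairing` with the outgoing velocities as arguments of `f`. -/
def gainPairing (f Ψ Φ : ℝ → Phase d → ℝ) (i j : Fin 4) (p : ℝ × Coll d) : ℝ :=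
  gainDensity (f p.1) p.2 * Ψ p.1 (particle i p.2) * Φ p.1 (particle j p.2)

theorem measurable_lossPairing (hf : Measurable fun p : ℝ × Phase d => f p.1 p.2)
    (hΨ : Measurable fun p : ℝ × Phase d => Ψ p.1 p.2)
    (hΦ : Measurable fun p : ℝ × Phase d => Φ p.1 p.2) (i j : Fin 4) :
    Measurable (lossPairing f Ψ Φ i j) :=
  ((measurable_lossDensity hf).mul
    (hΨ.comp (measurable_fst.prodMk ((measurable_particle i).comp measurable_snd)))).mul
    (hΦ.comp (measurable_fst.prodMk ((measurable_particle j).comp measurable_snd)))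

theorem measurable_gainPairing (hf : Measurable fun p : ℝ × Phase d => f p.1 p.2)
    (hΨ : Measurable fun p : ℝ × Phase d => Ψ p.1 p.2)
    (hΦ : Measurable fun p : ℝ × Phase d => Φ p.1 p.2) (i j : Fin 4) :
    Measurable (gainPairing f Ψ Φ i j) :=
  ((measurable_gainDensity hf).mul
    (hΨ.comp (measurable_fst.prodMk ((measurable_particle i).comp measurable_snd)))).mul
    (hΦ.comp (measurable_fst.prodMk ((measurable_particle j).comp measurable_snd)))

theorem IsShortTime.integrable_lossPairing (H : IsShortTime β₀ M T f) (hs : s ≤ T)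
    (hΨ : IsBoundedL2 (3 * β₀ / 4) s Ψ) (hΦ : IsBoundedL2 (3 * β₀ / 4) s Φ) (i j : Fin 4) :
    Integrable (lossPairing f Ψ Φ i j) ((volume.restrict (Ioc 0 s)).prod (collMeasure d)) :=
  integrable_pairing H.β₀_pos (measurable_lossDensity H.measurable)
    (fun _ hu q => H.abs_lossDensity_le ⟨hu.1, hu.2.trans hs⟩ q) hΨ hΦ i j

theorem IsShortTime.integrable_gainPairing (H : IsShortTime β₀ M T f) (hs : s ≤ T)
    (hΨ : IsBoundedL2 (3 * β₀ / 4) s Ψ) (hΦ : IsBoundedL2 (3 * β₀ / 4) s Φ) (i j : Fin 4) :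
    Integrable (gainPairing f Ψ Φ i j) ((volume.restrict (Ioc 0 s)).prod (collMeasure d)) :=
  integrable_pairing H.β₀_pos (measurable_gainDensity H.measurable)
    (fun _ hu q => H.abs_gainDensity_le ⟨hu.1, hu.2.trans hs⟩ q) hΨ hΦ i j

/-- The integral of `lossPairing` over `[0, s]` and over all collisions. -/
def pairingIntegral (f Ψ Φ : ℝ → Phase d → ℝ) (s : ℝ) (i j : Fin 4) : ℝ :=
  ∫ p, lossPairing f Ψ Φ i j p ∂((volume.restrict (Ioc 0 s)).prod (collMeasure d))

theorem pairingIntegral_exchange (hf : Measurable fun p : ℝ × Phase d => f p.1 p.2)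
    (hΨ : Measurable fun p : ℝ × Phase d => Ψ p.1 p.2)
    (hΦ : Measurable fun p : ℝ × Phase d => Φ p.1 p.2) (s : ℝ) (i j : Fin 4) :
    pairingIntegral f Ψ Φ s (![1, 0, 3, 2] i) (![1, 0, 3, 2] j) = pairingIntegral f Ψ Φ s i j := by
  have hmp := (MeasurePreserving.id (volume.restrict (Ioc 0 s))).prod
    (measurePreserving_exchange (d := d))
  rw [pairingIntegral, pairingIntegral,
    ← hmp.integral_comp_of_measurable (measurable_lossPairing hf hΨ hΦ i j)]
  simp only [lossPairing, Prod.map_fst, Prod.map_snd, id_eq, lossDensity_exchange,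
    particle_exchange]

/-- Reversal turns gain into loss and moves the arguments of the test functions from incoming to
outgoing positions, so gain terms need no separate family of integrals. -/
theorem integral_gainPairing (hf : Measurable fun p : ℝ × Phase d => f p.1 p.2)
    (hΨ : Measurable fun p : ℝ × Phase d => Ψ p.1 p.2)
    (hΦ : Measurable fun p : ℝ × Phase d => Φ p.1 p.2) (s : ℝ) (i j : Fin 4) :
    ∫ p, gainPairing f Ψ Φ (![2, 3, 0, 1] i) (![2, 3, 0, 1] j) p
      ∂((volume.restrict (Ioc 0 s)).prod (collMeasure d)) = pairingIntegral f Ψ Φ s i j := by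
  have hmp := (MeasurePreserving.id (volume.restrict (Ioc 0 s))).prod
    (measurePreserving_reverse (d := d))
  rw [pairingIntegral,
    ← hmp.integral_comp_of_measurable (measurable_lossPairing hf hΨ hΦ i j)]
  simp only [lossPairing, gainPairing, Prod.map_fst, Prod.map_snd, id_eq, lossDensity_reverse,
    particle_reverse]

theorem covDensity_eq (u : ℝ) (q : Coll d) : covDensity (f u) (Ψ u) (Φ u) q
    = ∑ i, ∑ j, collSign i * collSign j * lossPairing f Ψ Φ i j (u, q) := by
  have h : covDensity (f u) (Ψ u) (Φ u) q = lossDensity (f u) q *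
      (∑ i, collSign i * Ψ u (particle i q)) * ∑ j, collSign j * Φ u (particle j q) := by
    rw [← collDiff_eq_sum, ← collDiff_eq_sum]
    change _ = f u (q.1.1, q.1.2.1) * f u (q.1.1, q.1.2.2) * kernel q.1.2.1 q.1.2.2 q.2 * _ * _
    rw [covDensity]
    ring
  rw [h, mul_assoc, Finset.sum_mul_sum, Finset.mul_sum]
  refine Finset.sum_congr rfl fun i _ => ?_
  rw [Finset.mul_sum]
  refine Finset.sum_congr rfl fun j _ => ?_
  rw [lossPairing]
  ring

theorem recollisionDensity_eq (u : ℝ) (q : Torus d × Vel d × Vel d) :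
    recollisionDensity (f u) (Ψ u) (Φ u) q
      = ∫ ω, (gainPairing f Ψ Φ 2 3 (u, (q, ω)) - lossPairing f Ψ Φ 2 3 (u, (q, ω))) ∂(surf d) := by
  rw [recollisionDensity, recollision, ← integral_mul_const, ← integral_mul_const]
  refine integral_congr_ae (Eventually.of_forall fun ω => ?_)
  simp only [gainPairing, lossPairing, gainDensity, lossDensity, particle, crossSection]
  simp
  ring

theorem collisionOp_mul_mul_eq (u : ℝ) (z : Phase d) :
    collisionOp (f u) z * Ψ u z * Φ u z
      = ∫ y, (gainPairing f Ψ Φ 2 2 (u, toColl (z, y)) - lossPairing f Ψ Φ 2 2 (u, toColl (z, y)))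
        ∂((volume : Measure (Vel d)).prod (surf d)) := by
  rw [collisionOp, ← integral_mul_const, ← integral_mul_const]
  refine integral_congr_ae (Eventually.of_forall fun ω => ?_)
  simp only [gainPairing, lossPairing, gainDensity, lossDensity, particle, crossSection, toColl]
  simp
  ring

theorem linAdjoint_left_eq (u : ℝ) (z : Phase d) :
    f u z * linAdjoint (f u) (Ψ u) z * Φ u z
      = ∫ y, ∑ i, collSign i * lossPairing f Ψ Φ i 2 (u, toColl (z, y))
        ∂((volume : Measure (Vel d)).prod (surf d)) := by
  rw [linAdjoint, ← integral_const_mul, ← integral_mul_const]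
  refine integral_congr_ae (Eventually.of_forall fun y => ?_)
  dsimp only
  rw [linAdjoint_integrand_eq, Finset.mul_sum, Finset.sum_mul]
  refine Finset.sum_congr rfl fun i _ => ?_
  change _ = collSign i * (f u z * f u (z.1, y.1) * kernel z.2 y.1 y.2 * _ * Φ u z)
  ring

theorem linAdjoint_right_eq (u : ℝ) (z : Phase d) :
    f u z * Ψ u z * linAdjoint (f u) (Φ u) z
      = ∫ y, ∑ j, collSign j * lossPairing f Ψ Φ 2 j (u, toColl (z, y))
        ∂((volume : Measure (Vel d)).prod (surf d)) := by
  rw [linAdjoint, ← integral_const_mul]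
  refine integral_congr_ae (Eventually.of_forall fun y => ?_)
  dsimp only
  rw [linAdjoint_integrand_eq, Finset.mul_sum]
  refine Finset.sum_congr rfl fun i _ => ?_
  change _ = collSign i * (f u z * f u (z.1, y.1) * kernel z.2 y.1 y.2 * Ψ u z * _)
  ring

end Pairing

end

/-! ### The fluctuation-dissipation identity and the evolution of `∫ f Ψ Φ`. -/

section

variable {d : ℕ} {β₀ M T : ℝ} {f : ℝ → Phase d → ℝ}

section Algebra

variable {Ψ Φ : ℝ → Phase d → ℝ} {s : ℝ}

/-- The time derivative along the characteristics of `f Ψ Φ`. -/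
def productRate (f Ψ Φ : ℝ → Phase d → ℝ) (p : ℝ × Phase d) : ℝ :=
  collisionOp (f p.1) p.2 * Ψ p.1 p.2 * Φ p.1 p.2
    - f p.1 p.2 * linAdjoint (f p.1) (Ψ p.1) p.2 * Φ p.1 p.2
    - f p.1 p.2 * Ψ p.1 p.2 * linAdjoint (f p.1) (Φ p.1) p.2

namespace IsShortTime

theorem integrable_covDensity (H : IsShortTime β₀ M T f) (hs : s ≤ T)
    (hΨ : IsBoundedL2 (3 * β₀ / 4) s Ψ) (hΦ : IsBoundedL2 (3 * β₀ / 4) s Φ) :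
    Integrable (fun p : ℝ × Coll d => covDensity (f p.1) (Ψ p.1) (Φ p.1) p.2)
      ((volume.restrict (Ioc 0 s)).prod (collMeasure d)) ∧
    ∫ p : ℝ × Coll d, covDensity (f p.1) (Ψ p.1) (Φ p.1) p.2
      ∂((volume.restrict (Ioc 0 s)).prod (collMeasure d))
      = ∑ i, ∑ j, collSign i * collSign j * pairingIntegral f Ψ Φ s i j := by
  have hi := fun i j => (H.integrable_lossPairing hs hΨ hΦ i j).const_mul (collSign i * collSign j)
  simp_rw [covDensity_eq]
  refine ⟨integrable_finsetSum _ fun i _ => integrable_finsetSum _ fun j _ => hi i j, ?_⟩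
  rw [integral_finsetSum _ fun i _ => integrable_finsetSum _ fun j _ => hi i j]
  refine Finset.sum_congr rfl fun i _ => ?_
  rw [integral_finsetSum _ fun j _ => hi i j]
  exact Finset.sum_congr rfl fun j _ => integral_const_mul _ _

theorem integrable_recollisionDensity (H : IsShortTime β₀ M T f) (hs : s ≤ T)
    (hΨ : IsBoundedL2 (3 * β₀ / 4) s Ψ) (hΦ : IsBoundedL2 (3 * β₀ / 4) s Φ) :
    Integrable (fun p : ℝ × (Torus d × Vel d × Vel d) =>
      recollisionDensity (f p.1) (Ψ p.1) (Φ p.1) p.2) ((volume.restrict (Ioc 0 s)).prod volume) ∧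
    ∫ p : ℝ × (Torus d × Vel d × Vel d), recollisionDensity (f p.1) (Ψ p.1) (Φ p.1) p.2
      ∂((volume.restrict (Ioc 0 s)).prod volume)
      = pairingIntegral f Ψ Φ s 0 1 - pairingIntegral f Ψ Φ s 2 3 := by
  have hg := H.integrable_gainPairing hs hΨ hΦ 2 3
  have hl := H.integrable_lossPairing hs hΨ hΦ 2 3
  have hm := (measurable_gainPairing H.measurable hΨ.measurable hΦ.measurable 2 3).sub
    (measurable_lossPairing H.measurable hΨ.measurable hΦ.measurable 2 3)
  have h := integrable_integral_sph hm (hg.sub hl)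
  simp_rw [recollisionDensity_eq]
  refine ⟨h.1, h.2.trans ?_⟩
  have e := integral_gainPairing H.measurable hΨ.measurable hΦ.measurable s 0 1
  exact (integral_sub hg hl).trans (congrArg (· - _) e)

theorem integrable_collisionOp_mul_mul (H : IsShortTime β₀ M T f) (hs : s ≤ T)
    (hΨ : IsBoundedL2 (3 * β₀ / 4) s Ψ) (hΦ : IsBoundedL2 (3 * β₀ / 4) s Φ) :
    Integrable (fun p : ℝ × Phase d => collisionOp (f p.1) p.2 * Ψ p.1 p.2 * Φ p.1 p.2)
      ((volume.restrict (Ioc 0 s)).prod volume) ∧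
    ∫ p : ℝ × Phase d, collisionOp (f p.1) p.2 * Ψ p.1 p.2 * Φ p.1 p.2
      ∂((volume.restrict (Ioc 0 s)).prod volume)
      = pairingIntegral f Ψ Φ s 0 0 - pairingIntegral f Ψ Φ s 2 2 := by
  have hg := H.integrable_gainPairing hs hΨ hΦ 2 2
  have hl := H.integrable_lossPairing hs hΨ hΦ 2 2
  have hm := (measurable_gainPairing H.measurable hΨ.measurable hΦ.measurable 2 2).sub
    (measurable_lossPairing H.measurable hΨ.measurable hΦ.measurable 2 2)
  have h := integrable_integral_toColl hm (hg.sub hl)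
  simp_rw [collisionOp_mul_mul_eq]
  refine ⟨h.1, h.2.trans ?_⟩
  have e := integral_gainPairing H.measurable hΨ.measurable hΦ.measurable s 0 0
  exact (integral_sub hg hl).trans (congrArg (· - _) e)

theorem integrable_linAdjoint_left (H : IsShortTime β₀ M T f) (hs : s ≤ T)
    (hΨ : IsBoundedL2 (3 * β₀ / 4) s Ψ) (hΦ : IsBoundedL2 (3 * β₀ / 4) s Φ) :
    Integrable (fun p : ℝ × Phase d => f p.1 p.2 * linAdjoint (f p.1) (Ψ p.1) p.2 * Φ p.1 p.2)
      ((volume.restrict (Ioc 0 s)).prod volume) ∧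
    ∫ p : ℝ × Phase d, f p.1 p.2 * linAdjoint (f p.1) (Ψ p.1) p.2 * Φ p.1 p.2
      ∂((volume.restrict (Ioc 0 s)).prod volume)
      = ∑ i, collSign i * pairingIntegral f Ψ Φ s i 2 := by
  have hi := fun i => (H.integrable_lossPairing hs hΨ hΦ i 2).const_mul (collSign i)
  have hm := Finset.measurable_sum (Finset.univ : Finset (Fin 4)) fun i _ =>
    (measurable_lossPairing H.measurable hΨ.measurable hΦ.measurable i 2).const_mul (collSign i)
  have h := integrable_integral_toColl hm (integrable_finsetSum _ fun i _ => hi i)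
  simp_rw [linAdjoint_left_eq]
  refine ⟨h.1, h.2.trans ?_⟩
  rw [integral_finsetSum _ fun i _ => hi i]
  exact Finset.sum_congr rfl fun i _ => integral_const_mul _ _

theorem integrable_linAdjoint_right (H : IsShortTime β₀ M T f) (hs : s ≤ T)
    (hΨ : IsBoundedL2 (3 * β₀ / 4) s Ψ) (hΦ : IsBoundedL2 (3 * β₀ / 4) s Φ) :
    Integrable (fun p : ℝ × Phase d => f p.1 p.2 * Ψ p.1 p.2 * linAdjoint (f p.1) (Φ p.1) p.2)
      ((volume.restrict (Ioc 0 s)).prod volume) ∧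
    ∫ p : ℝ × Phase d, f p.1 p.2 * Ψ p.1 p.2 * linAdjoint (f p.1) (Φ p.1) p.2
      ∂((volume.restrict (Ioc 0 s)).prod volume)
      = ∑ j, collSign j * pairingIntegral f Ψ Φ s 2 j := by
  have hi := fun j => (H.integrable_lossPairing hs hΨ hΦ 2 j).const_mul (collSign j)
  have hm := Finset.measurable_sum (Finset.univ : Finset (Fin 4)) fun j _ =>
    (measurable_lossPairing H.measurable hΨ.measurable hΦ.measurable 2 j).const_mul (collSign j)
  have h := integrable_integral_toColl hm (integrable_finsetSum _ fun j _ => hi j)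
  simp_rw [linAdjoint_right_eq]
  refine ⟨h.1, h.2.trans ?_⟩
  rw [integral_finsetSum _ fun j _ => hi j]
  exact Finset.sum_congr rfl fun j _ => integral_const_mul _ _

theorem integrable_productRate (H : IsShortTime β₀ M T f) (hs : s ≤ T)
    (hΨ : IsBoundedL2 (3 * β₀ / 4) s Ψ) (hΦ : IsBoundedL2 (3 * β₀ / 4) s Φ) :
    Integrable (productRate f Ψ Φ) ((volume.restrict (Ioc 0 s)).prod volume) :=
  ((H.integrable_collisionOp_mul_mul hs hΨ hΦ).1.sub (H.integrable_linAdjoint_left hs hΨ hΦ).1).sub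
    (H.integrable_linAdjoint_right hs hΨ hΦ).1

/-- The noise covariance compensates the dissipation and the recollisions. -/
theorem half_integral_covDensity_eq (H : IsShortTime β₀ M T f) (hs : s ≤ T)
    (hΨ : IsBoundedL2 (3 * β₀ / 4) s Ψ) (hΦ : IsBoundedL2 (3 * β₀ / 4) s Φ) :
    1 / 2 * ∫ p : ℝ × Coll d, covDensity (f p.1) (Ψ p.1) (Φ p.1) p.2
      ∂((volume.restrict (Ioc 0 s)).prod (collMeasure d))
    = (∫ p, productRate f Ψ Φ p ∂((volume.restrict (Ioc 0 s)).prod volume))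
      + ∫ p : ℝ × (Torus d × Vel d × Vel d), recollisionDensity (f p.1) (Ψ p.1) (Φ p.1) p.2
        ∂((volume.restrict (Ioc 0 s)).prod volume) := by
  have hc := H.integrable_collisionOp_mul_mul hs hΨ hΦ
  have hl := H.integrable_linAdjoint_left hs hΨ hΦ
  have hr := H.integrable_linAdjoint_right hs hΨ hΦ
  have hW : ∫ p, productRate f Ψ Φ p ∂((volume.restrict (Ioc 0 s)).prod volume)
      = pairingIntegral f Ψ Φ s 0 0 - pairingIntegral f Ψ Φ s 2 2
        - ∑ i, collSign i * pairingIntegral f Ψ Φ s i 2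
        - ∑ j, collSign j * pairingIntegral f Ψ Φ s 2 j := by
    rw [← hc.2, ← hl.2, ← hr.2, ← integral_sub hc.1 hl.1]
    exact integral_sub (hc.1.sub hl.1) hr.1
  rw [(H.integrable_covDensity hs hΨ hΦ).2, hW, (H.integrable_recollisionDensity hs hΨ hΦ).2]
  -- Modulo the exchange symmetry, half the covariance is `P00 + P01 + P22 + P23 - P02 - P03 - P20 -
  -- P21`. The product rate is `P00 + P22 + 2 P23 - P02 - P03 - P20 - P21`, and the recollision term
  -- `P01 - P23` is exactly the difference.
  have he := pairingIntegral_exchange H.measurable hΨ.measurable hΦ.measurable s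
  have e00 := he 0 0
  have e22 := he 2 2
  have e01 := he 0 1
  have e23 := he 2 3
  have e02 := he 0 2
  have e03 := he 0 3
  have e20 := he 2 0
  have e21 := he 2 1
  simp only [Fin.isValue, Matrix.cons_val] at e00 e22 e01 e23 e02 e03 e20 e21
  simp only [Fin.sum_univ_four, collSign, Fin.isValue, Matrix.cons_val]
  linarith

end IsShortTime

end Algebra

/-- Taking both test functions equal to `1` makes the pairing estimates yield the integrability of
the collision operator itself. -/
theorem isBoundedL2_one {a : ℝ} (ha : 0 < a) (s : ℝ) :
    IsBoundedL2 a s (fun _ _ => 1 : ℝ → Phase d → ℝ) := by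
  refine ⟨measurable_const, wnorm a (fun _ : Phase d => ‖(1 : ℝ)‖ₑ), ?_, fun u _ => le_rfl⟩
  have h2 := (integrable_const (μ := (volume : Measure (Torus d))) (1 : ℝ)).mul_prod
    (integrable_gaussian (d := d) ha)
  have h3 := h2.lintegral_lt_top
  refine ne_of_lt ?_
  simpa [wnorm, Measure.volume_eq_prod] using h3

theorem IsBackwardSolution.isBoundedL2 {t s : ℝ} {ψ : Phase d → ℝ} {Ψ : ℝ → Phase d → ℝ}
    (h : IsBackwardSolution β₀ f t ψ Ψ) (hst : s ≤ t) : IsBoundedL2 (3 * β₀ / 4) s Ψ := by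
  obtain ⟨A, hA, hle⟩ := h.exists_wnorm_le
  exact ⟨h.measurable, A, hA, fun u hu => hle u ⟨hu.1, hu.2.trans hst⟩⟩

theorem IsShortTime.integrable_mul_mul (H : IsShortTime β₀ M T f) {s u : ℝ} (hs : s ≤ T)
    (hu : u ∈ Icc 0 s) {Ψ Φ : ℝ → Phase d → ℝ}
    (hΨ : IsBoundedL2 (3 * β₀ / 4) s Ψ) (hΦ : IsBoundedL2 (3 * β₀ / 4) s Φ) :
    Integrable fun z => f u z * Ψ u z * Φ u z := by
  obtain ⟨CA, hCA, hA'⟩ := hΨ.bound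
  obtain ⟨CB, hCB, hB'⟩ := hΦ.bound
  have hm : ∀ {D : ℝ → Phase d → ℝ}, (Measurable fun p : ℝ × Phase d => D p.1 p.2) →
      Measurable (D u) := fun hD => hD.comp (measurable_prodMk_left (x := u))
  have m1 : Measurable fun z : Phase d =>
      ENNReal.ofReal (Real.exp (-(3 * β₀ / 4 / 2 * ‖z.2‖ ^ 2))) * ‖Ψ u z‖ₑ ^ 2 :=
    (measurable_weight _).mul ((hm hΨ.measurable).enorm.pow_const 2)
  refine ⟨(((hm H.measurable).mul (hm hΨ.measurable)).mul
    (hm hΦ.measurable)).aestronglyMeasurable, ?_⟩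
  have hβ := H.β₀_pos
  have hM := H.M_nonneg
  calc ∫⁻ z, ‖f u z * Ψ u z * Φ u z‖ₑ
      ≤ ∫⁻ z, ENNReal.ofReal M *
        (ENNReal.ofReal (Real.exp (-(3 * β₀ / 4 / 2 * ‖z.2‖ ^ 2))) * ‖Ψ u z‖ₑ ^ 2 +
        ENNReal.ofReal (Real.exp (-(3 * β₀ / 4 / 2 * ‖z.2‖ ^ 2))) * ‖Φ u z‖ₑ ^ 2) := by
        refine lintegral_mono fun z => ?_
        rw [enorm_mul, enorm_mul, mul_assoc, ← mul_add, ← mul_assoc (ENNReal.ofReal M),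
          ← ENNReal.ofReal_mul hM, Real.enorm_eq_ofReal_abs (f u z)]
        refine mul_le_mul' (ENNReal.ofReal_le_ofReal ?_) (mul_le_sq_add_sq _ _)
        refine (H.bound u ⟨hu.1, hu.2.trans hs⟩ z).trans ?_
        refine mul_le_mul_of_nonneg_left (Real.exp_le_exp.2 ?_) hM
        nlinarith [mul_nonneg hβ.le (sq_nonneg ‖z.2‖)]
    _ = ENNReal.ofReal M * (wnorm (3 * β₀ / 4) (fun z => ‖Ψ u z‖ₑ) +
        wnorm (3 * β₀ / 4) (fun z => ‖Φ u z‖ₑ)) := by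
        rw [lintegral_const_mul' _ _ ENNReal.ofReal_ne_top, lintegral_add_left m1]
        rfl
    _ < ∞ := ENNReal.mul_lt_top ENNReal.ofReal_lt_top (ENNReal.add_lt_top.2
        ⟨(hA' u hu).trans_lt hCA.lt_top, (hB' u hu).trans_lt hCB.lt_top⟩)

theorem IsBoltzmannSolution.transport {Tstar M' : ℝ} {f₀ : Phase d → ℝ}
    (h : IsBoltzmannSolution β₀ Tstar M' f₀ f) {u : ℝ} (hu : u ∈ Icc 0 Tstar) (z : Phase d) :
    f u (shift u z) = f₀ z + ∫ σ in (0 : ℝ)..u, collisionOp (f σ) (shift σ z) := by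
  rw [h.equation u hu, shift_shift, neg_add_cancel, shift_zero]
  simp_rw [shift_shift, neg_sub, sub_add_cancel]

namespace IsBackwardSolution

variable {t : ℝ} {ψ : Phase d → ℝ} {Ψ : ℝ → Phase d → ℝ}

theorem ae_integrableOn (h : IsBackwardSolution β₀ f t ψ Ψ) (H : IsShortTime β₀ M T f)
    (ht : t ∈ Icc 0 T) :
    ∀ᵐ z, IntegrableOn (fun σ => linAdjoint (f σ) (Ψ σ) (shift σ z)) (Ioc 0 t) := by
  filter_upwards [h.ae_absStep_lt_top H ht.2 ⟨le_rfl, ht.1⟩] with z hz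
  simpa using integrableOn_linAdjoint H.measurable h.measurable hz

theorem transport (h : IsBackwardSolution β₀ f t ψ Ψ) (H : IsShortTime β₀ M T f)
    (ht : t ∈ Icc 0 T) {u : ℝ} (hu : u ∈ Icc 0 t) :
    ∀ᵐ z, Ψ u (shift u z) = Ψ 0 z - ∫ σ in Ioc 0 u, linAdjoint (f σ) (Ψ σ) (shift σ z) := by
  filter_upwards [h.equation 0 ⟨le_rfl, ht.1⟩, h.ae_integrableOn H ht,
    (measurePreserving_shift (d := d) u).quasiMeasurePreserving.ae (h.equation u hu)] with z h0 hi hz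
  rw [hz, h0, shift_shift]
  simp_rw [shift_shift, sub_add_cancel, sub_zero]
  have hI : IntervalIntegrable (fun σ => linAdjoint (f σ) (Ψ σ) (shift σ z)) volume 0 t :=
    (intervalIntegrable_iff_integrableOn_Ioc_of_le ht.1).2 hi
  have hsub : uIcc 0 u ⊆ uIcc 0 t := by
    rw [uIcc_of_le hu.1, uIcc_of_le ht.1]; exact Icc_subset_Icc_right hu.2
  have hsub' : uIcc u t ⊆ uIcc 0 t := by
    rw [uIcc_of_le hu.2, uIcc_of_le ht.1]; exact Icc_subset_Icc_left hu.1
  rw [← intervalIntegral.integral_of_le hu.1,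
    ← intervalIntegral.integral_add_adjacent_intervals (hI.mono_set hsub) (hI.mono_set hsub')]
  ring

/-- The Duhamel equation has an exceptional null set for each time. Fubini exchanges the
quantifiers, so that almost every characteristic satisfies it at almost every time; the
measurability of the set of good pairs is the point to check. -/
theorem ae_transport (h : IsBackwardSolution β₀ f t ψ Ψ) (H : IsShortTime β₀ M T f)
    (ht : t ∈ Icc 0 T) {s : ℝ} (hs : s ≤ t) :
    ∀ᵐ z, ∀ᵐ u ∂(volume.restrict (Ioc 0 s)),
      Ψ u (shift u z) = Ψ 0 z - ∫ σ in Ioc 0 u, linAdjoint (f σ) (Ψ σ) (shift σ z) := by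
  rw [Measure.ae_ae_comm]
  · refine (ae_restrict_iff' measurableSet_Ioc).2 (Eventually.of_forall fun u hu => ?_)
    exact h.transport H ht ⟨hu.1.le, hu.2.trans hs⟩
  · have m1 : Measurable fun p : Phase d × ℝ => Ψ p.2 (shift p.2 p.1) :=
      h.measurable.comp (measurable_snd.prodMk (measurable_shift measurable_snd measurable_fst))
    have m2 : Measurable fun p : Phase d × ℝ => Ψ 0 p.1 :=
      (h.measurable_apply 0).comp measurable_fst
    have m3 : Measurable fun q : (Phase d × ℝ) × ℝ =>
        linAdjoint (f q.2) (Ψ q.2) (shift q.2 q.1.1) :=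
      measurable_linAdjoint (g := fun q : (Phase d × ℝ) × ℝ => f q.2)
        (ψ := fun q : (Phase d × ℝ) × ℝ => Ψ q.2)
        (H.measurable.comp (measurable_fst.snd.prodMk measurable_snd))
        (h.measurable.comp (measurable_fst.snd.prodMk measurable_snd))
        (measurable_shift measurable_snd measurable_fst.fst)
    have hset : MeasurableSet {q : (Phase d × ℝ) × ℝ | 0 < q.2 ∧ q.2 ≤ q.1.2} :=
      (measurableSet_lt measurable_const measurable_snd).inter
        (measurableSet_le measurable_snd measurable_fst.snd)
    have m4 : Measurable fun p : Phase d × ℝ =>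
        ∫ σ in Ioc 0 p.2, linAdjoint (f σ) (Ψ σ) (shift σ p.1) := by
      simp_rw [← integral_indicator measurableSet_Ioc]
      exact ((m3.indicator hset).stronglyMeasurable.integral_prod_right').measurable
    exact measurableSet_eq_fun m1 (m2.sub m4)

end IsBackwardSolution

/-- The evolution of `∫ f Ψ Φ` for two solutions of the backward linearized equation. -/
theorem integral_productRate {Tstar M' : ℝ} {f₀ : Phase d → ℝ}
    (hB : IsBoltzmannSolution β₀ Tstar M' f₀ f) (H : IsShortTime β₀ M T f) (hT : T ≤ Tstar)
    {s t : ℝ} (hs : 0 ≤ s) (hst : s ≤ t) (ht : t ≤ T) {ψ φ : Phase d → ℝ}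
    {Ψ Φ : ℝ → Phase d → ℝ} (hΨ : IsBackwardSolution β₀ f t ψ Ψ)
    (hΦ : IsBackwardSolution β₀ f s φ Φ) :
    ∫ p, productRate f Ψ Φ p ∂((volume.restrict (Ioc 0 s)).prod volume)
      = (∫ z, f s z * Ψ s z * Φ s z) - ∫ z, f 0 z * Ψ 0 z * Φ 0 z := by
  have hsT := hst.trans ht
  have bΨ := hΨ.isBoundedL2 hst
  have bΦ := hΦ.isBoundedL2 le_rfl
  have h1 := isBoundedL2_one (d := d) (by linarith [H.β₀_pos] : 0 < 3 * β₀ / 4) s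
  have hW := H.integrable_productRate hsT bΨ bΦ
  have hQ := (H.integrable_collisionOp_mul_mul hsT h1 h1).1
  simp only [mul_one] at hQ
  have hmp : MeasurePreserving (fun p : ℝ × Phase d => (p.1, shift p.1 p.2))
      ((volume.restrict (Ioc 0 s)).prod volume) ((volume.restrict (Ioc 0 s)).prod volume) :=
    (MeasurePreserving.id _).skew_product (g := fun u z => shift u z)
      (measurable_shift measurable_fst measurable_snd)
      (Eventually.of_forall fun u => (measurePreserving_shift u).map_eq)
  have hWs := hmp.integrable_comp_of_integrable hW
  have hQs := hmp.integrable_comp_of_integrable hQ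
  have hi0 := H.integrable_mul_mul hsT ⟨le_rfl, hs⟩ bΨ bΦ
  have his := H.integrable_mul_mul hsT ⟨hs, le_rfl⟩ bΨ bΦ
  have hiss := (measurePreserving_shift (d := d) s).integrable_comp_of_integrable his
  have hae : ∀ᵐ z, ∫ u in Ioc 0 s, productRate f Ψ Φ (u, shift u z)
      = f s (shift s z) * Ψ s (shift s z) * Φ s (shift s z) - f 0 z * Ψ 0 z * Φ 0 z := by
    filter_upwards [hQs.prod_left_ae, hΨ.ae_integrableOn H ⟨hs.trans hst, ht⟩,
      hΦ.ae_integrableOn H ⟨hs, hsT⟩, hΨ.ae_transport H ⟨hs.trans hst, ht⟩ hst,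
      hΦ.ae_transport H ⟨hs, hsT⟩ le_rfl, hΨ.transport H ⟨hs.trans hst, ht⟩ ⟨hs, hst⟩,
      hΦ.transport H ⟨hs, hsT⟩ ⟨hs, le_rfl⟩] with z iq il im tΨ tΦ tΨs tΦs
    have jq : IntervalIntegrable (fun u => collisionOp (f u) (shift u z)) volume 0 s :=
      (intervalIntegrable_iff_integrableOn_Ioc_of_le hs).2 iq
    have jl : IntervalIntegrable (fun u => -linAdjoint (f u) (Ψ u) (shift u z)) volume 0 s :=
      ((intervalIntegrable_iff_integrableOn_Ioc_of_le hs).2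
        (il.mono_set (Ioc_subset_Ioc_right hst))).neg
    have jm : IntervalIntegrable (fun u => -linAdjoint (f u) (Φ u) (shift u z)) volume 0 s :=
      ((intervalIntegrable_iff_integrableOn_Ioc_of_le hs).2 im).neg
    -- The product rule is applied to the primitives, which are defined for every `u`. They agree
    -- with `f`, `Ψ`, `Φ` along the characteristic at almost every `u`, and, for almost every `z`,
    -- at the endpoint `s` through the fixed-time `transport`.
    have htri := integral_triple_product (a₀ := f₀ z) (b₀ := Ψ 0 z) (c₀ := Φ 0 z) jq jl jm
      (fun _ => rfl) (fun _ => rfl) (fun _ => rfl)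
    have eΨ : ∀ {u}, 0 ≤ u →
        Ψ 0 z - ∫ σ in Ioc 0 u, linAdjoint (f σ) (Ψ σ) (shift σ z)
        = Ψ 0 z + ∫ σ in (0 : ℝ)..u, -linAdjoint (f σ) (Ψ σ) (shift σ z) := fun hu => by
      rw [intervalIntegral.integral_neg, intervalIntegral.integral_of_le hu, sub_eq_add_neg]
    have eΦ : ∀ {u}, 0 ≤ u →
        Φ 0 z - ∫ σ in Ioc 0 u, linAdjoint (f σ) (Φ σ) (shift σ z)
        = Φ 0 z + ∫ σ in (0 : ℝ)..u, -linAdjoint (f σ) (Φ σ) (shift σ z) := fun hu => by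
      rw [intervalIntegral.integral_neg, intervalIntegral.integral_of_le hu, sub_eq_add_neg]
    have hf0 : f 0 z = f₀ z := by
      have := hB.transport (u := 0) ⟨le_rfl, hs.trans (hsT.trans hT)⟩ z
      simpa [shift_zero] using this
    rw [tΨs, tΦs, eΨ hs, eΦ hs, hB.transport ⟨hs, hsT.trans hT⟩ z, hf0, htri,
      intervalIntegral.integral_of_le hs]
    refine integral_congr_ae ?_
    filter_upwards [tΨ, tΦ, ae_restrict_mem measurableSet_Ioc] with u uΨ uΦ hu
    rw [← eΨ hu.1.le, ← eΦ hu.1.le, ← uΨ, ← uΦ,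
      ← hB.transport ⟨hu.1.le, hu.2.trans (hsT.trans hT)⟩ z, productRate]
    ring
  calc ∫ p, productRate f Ψ Φ p ∂((volume.restrict (Ioc 0 s)).prod volume)
      = ∫ p : ℝ × Phase d, productRate f Ψ Φ (p.1, shift p.1 p.2)
        ∂((volume.restrict (Ioc 0 s)).prod volume) := by
        rw [← hmp.map_eq, integral_map hmp.measurable.aemeasurable]
        · rw [hmp.map_eq]
        · rw [hmp.map_eq]; exact hW.1
    _ = ∫ z, ∫ u in Ioc 0 s, productRate f Ψ Φ (u, shift u z) := integral_prod_symm _ hWs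
    _ = ∫ z, (f s (shift s z) * Ψ s (shift s z) * Φ s (shift s z) - f 0 z * Ψ 0 z * Φ 0 z) :=
        integral_congr_ae hae
    _ = _ := by
        refine (integral_sub hiss hi0).trans ?_
        congr 1
        have hm : ∀ {D : ℝ → Phase d → ℝ}, (Measurable fun p : ℝ × Phase d => D p.1 p.2) →
          Measurable (D s) := fun hD => hD.comp (measurable_prodMk_left (x := s))
        exact (measurePreserving_shift s).integral_comp_of_measurable
          (F := fun z => f s z * Ψ s z * Φ s z)
          (((hm H.measurable).mul (hm hΨ.measurable)).mul (hm hΦ.measurable))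

end

/-! ### Choice of the short time and identification of the propagator. -/

section

variable {d : ℕ} {β₀ M T Tstar : ℝ} {f₀ : Phase d → ℝ} {f : ℝ → Phase d → ℝ}

/-- A time on which all Boltzmann solutions with the given bounds are in the scope of
`IsShortTime`. -/
def shortTime (d : ℕ) (β₀ Tstar M : ℝ) : ℝ :=
  min (Tstar / 4) (min 1 (β₀ / (256 * (linConst d β₀ |M| + 1))))

theorem shortTime_pos (d : ℕ) (hβ₀ : 0 < β₀) (hTstar : 0 < Tstar) (M : ℝ) :
    0 < shortTime d β₀ Tstar M := by
  have := linConst_nonneg d hβ₀ |M|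
  unfold shortTime
  positivity

theorem shortTime_le (d : ℕ) (β₀ Tstar M : ℝ) : shortTime d β₀ Tstar M ≤ Tstar / 4 :=
  min_le_left _ _

/-- For times up to `Tstar/4` the factor `1 - t/(2 Tstar)` is at least `7/8`. The cap at `1` gives
`T² ≤ T`, so a bound linear in `T` suffices for smallness, and `|M|` dispenses with a sign condition
on `M`. -/
theorem IsBoltzmannSolution.isShortTime (hβ₀ : 0 < β₀) (hTstar : 0 < Tstar)
    (h : IsBoltzmannSolution β₀ Tstar M f₀ f) :
    IsShortTime β₀ |M| (shortTime d β₀ Tstar M) f := by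
  have hK := linConst_nonneg d hβ₀ |M|
  have hpos := shortTime_pos d hβ₀ hTstar M
  have h4 := shortTime_le d β₀ Tstar M
  have h1 : shortTime d β₀ Tstar M ≤ 1 := (min_le_right _ _).trans (min_le_left _ _)
  have h2 : shortTime d β₀ Tstar M ≤ β₀ / (256 * (linConst d β₀ |M| + 1)) :=
    (min_le_right _ _).trans (min_le_right _ _)
  refine ⟨hβ₀, abs_nonneg M, hpos, ?_, h.measurable, fun σ hσ z => ?_⟩
  · rw [le_div_iff₀ (by positivity)] at h2
    have h3 : shortTime d β₀ Tstar M ^ 2 ≤ shortTime d β₀ Tstar M := by nlinarith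
    have h5 := mul_le_mul_of_nonneg_left h3 hK
    nlinarith
  · refine (h.bound σ ⟨hσ.1, by linarith [hσ.2]⟩ z).trans ?_
    refine mul_le_mul (le_abs_self M) (Real.exp_le_exp.2 ?_) (Real.exp_nonneg _) (abs_nonneg M)
    have hs : σ / (2 * Tstar) ≤ 1 / 8 := by
      rw [div_le_div_iff₀ (by positivity) (by norm_num)]
      linarith [hσ.2]
    have hn : 0 ≤ β₀ / 2 * ‖z.2‖ ^ 2 := by positivity
    nlinarith [mul_le_mul_of_nonneg_left hs hn]

/-- The chosen solution does not depend on `u`, so the propagator inherits its joint measurability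
in time and phase. -/
theorem Ustar_eq {t : ℝ} {ψ : Phase d → ℝ} (h : ∃ Ψ, IsBackwardSolution β₀ f t ψ Ψ) (u : ℝ) :
    Ustar β₀ f t u ψ = h.choose u := dif_pos h

theorem IsBackwardSolution.ae_eq_terminal {t : ℝ} (ht : 0 ≤ t) {φ : Phase d → ℝ}
    {Φ : ℝ → Phase d → ℝ} (h : IsBackwardSolution β₀ f t φ Φ) : ∀ᵐ z, Φ t z = φ z := by
  filter_upwards [h.equation t ⟨ht, le_rfl⟩] with z hz
  simpa [shift_zero] using hz

end

end FluctuatingBoltzmann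

end

/-! ### Spohn's formula. -/

theorem mainTheorem10 (d : ℕ) (hd : 2 ≤ d) (β₀ Tstar M : ℝ) (hβ₀ : 0 < β₀) (hTstar : 0 < Tstar) :
    ∃ T : ℝ, 0 < T ∧ T ≤ Tstar ∧
      ∀ (f₀ : Phase d → ℝ) (f : ℝ → Phase d → ℝ), IsBoltzmannSolution β₀ Tstar M f₀ f →
        -- the backward propagator is well defined on `[0, T]`
        (∀ t ∈ Set.Icc 0 T, ∀ φ : Phase d → ℝ, MemL2 (β₀ / 2) φ →
          (∃ Ψ, IsBackwardSolution β₀ f t φ Ψ) ∧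
          (∀ Ψ₁ Ψ₂, IsBackwardSolution β₀ f t φ Ψ₁ → IsBackwardSolution β₀ f t φ Ψ₂ →
            ∀ s ∈ Set.Icc 0 t, ∀ᵐ z : Phase d, Ψ₁ s z = Ψ₂ s z)) ∧
        -- the formula for the covariance, all of whose integrals converge absolutely
        (∀ s t : ℝ, 0 ≤ s → s ≤ t → t ≤ T → ∀ φ ψ : Phase d → ℝ,
          MemL2 (β₀ / 2) φ → MemL2 (β₀ / 2) ψ →
          Integrable (fun z : Phase d => f₀ z * Ustar β₀ f t 0 ψ z * Ustar β₀ f s 0 φ z) ∧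
          Integrable (fun p : ℝ × ((Torus d × Vel d × Vel d) × Sph d) =>
              covDensity (f p.1) (Ustar β₀ f t p.1 ψ) (Ustar β₀ f s p.1 φ) p.2)
            ((volume.restrict (Set.Ioc 0 s)).prod
              ((volume : Measure (Torus d × Vel d × Vel d)).prod (surf d))) ∧
          Integrable (fun z : Phase d => Ustar β₀ f t s ψ z * φ z * f s z) ∧
          Integrable (fun p : ℝ × (Torus d × Vel d × Vel d) =>
              recollisionDensity (f p.1) (Ustar β₀ f t p.1 ψ) (Ustar β₀ f s p.1 φ) p.2)
            ((volume.restrict (Set.Ioc 0 s)).prod volume) ∧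
          limitCov β₀ f₀ f s t φ ψ =
            (∫ z : Phase d, Ustar β₀ f t s ψ z * φ z * f s z)
              + ∫ τ in (0 : ℝ)..s, ∫ q : Torus d × Vel d × Vel d,
                  recollisionDensity (f τ) (Ustar β₀ f t τ ψ) (Ustar β₀ f s τ φ) q) := by
  refine ⟨shortTime d β₀ Tstar M, shortTime_pos d hβ₀ hTstar M,
    (shortTime_le d β₀ Tstar M).trans (by linarith), fun f₀ f hf => ?_⟩
  have H := hf.isShortTime hβ₀ hTstar
  refine ⟨fun t ht φ hφ => ⟨H.exists_solution ht hφ, fun Ψ₁ Ψ₂ h₁ h₂ s hs =>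
    h₁.unique H ht.2 h₂ hs⟩, fun s t hs hst ht φ ψ hφ hψ => ?_⟩
  have hT : shortTime d β₀ Tstar M ≤ Tstar := (shortTime_le d β₀ Tstar M).trans (by linarith)
  have exΨ := H.exists_solution ⟨hs.trans hst, ht⟩ hψ
  have exΦ := H.exists_solution ⟨hs, hst.trans ht⟩ hφ
  have hΨ := exΨ.choose_spec
  have hΦ := exΦ.choose_spec
  simp only [limitCov, noiseCov, Ustar_eq exΨ, Ustar_eq exΦ]
  generalize exΨ.choose = Ψ at hΨ ⊢
  generalize exΦ.choose = Φ at hΦ ⊢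
  have hsT := hst.trans ht
  have bΨ := hΨ.isBoundedL2 hst
  have bΦ := hΦ.isBoundedL2 le_rfl
  have hf0 : f 0 = f₀ := by
    ext z
    simpa [shift_zero] using hf.transport (u := 0) ⟨le_rfl, hTstar.le⟩ z
  have hφΦ := hΦ.ae_eq_terminal hs
  have e0 : (fun z => f 0 z * Ψ 0 z * Φ 0 z) = fun z => f₀ z * Ψ 0 z * Φ 0 z := by rw [hf0]
  have es : (fun z => f s z * Ψ s z * Φ s z) =ᵐ[volume] fun z => Ψ s z * φ z * f s z := by
    filter_upwards [hφΦ] with z hz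
    rw [hz]; ring
  have hi0 := H.integrable_mul_mul hsT ⟨le_rfl, hs⟩ bΨ bΦ
  have his := H.integrable_mul_mul hsT ⟨hs, le_rfl⟩ bΨ bΦ
  have hcov := (H.integrable_covDensity hsT bΨ bΦ).1
  have hrec := (H.integrable_recollisionDensity hsT bΨ bΦ).1
  refine ⟨by rwa [← e0], hcov, his.congr es, hrec, ?_⟩
  have key := H.half_integral_covDensity_eq hsT bΨ bΦ
  -- The boundary term at time `0` cancels the initial covariance, and Fubini turns the space-time
  -- integrals into the iterated ones of the statement.
  rw [integral_productRate hf H hT hs hst ht hΨ hΦ, integral_prod _ hcov, integral_prod _ hrec] at key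
  rw [intervalIntegral.integral_const_mul, intervalIntegral.integral_of_le hs,
    intervalIntegral.integral_of_le hs, key, ← e0, integral_congr_ae es]
  ring
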